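/- Graphs are finite, undirected, have at least one vertex, and may have multiple edges and self-loops; a self-loop contributes $2$ to the degree of its vertex. For a vertex $v$ without self-loops, a transition $\tau\in\mathcal{T}(v)$ is a perfect matching of the edges at $v$, and $G_\tau$ is the graph obtained by deleting $v$ together with its edges and adding, for each pair $\{va,vb\}$ of $\tau$, a new edge $ab$. The Martin invariant $M(G)$ of a $2k$-regular graph $G$ is defined as follows. If $G$ has at least three vertices, then $M(G)=0$ if $G$ has a self-loop; $M(G)=1$ if $G$ has exactly three vertices and no self-loop; and otherwise $M(G)=\sum_{\tau\in\mathcal{T}(v)}M(G_\tau)$ for any vertex $v$. If $G$ has two vertices, then $M(G)=0$ if $G$ has a self-loop and $M(G)=1/k!$ if $G$ is the $2k$-fold edge; if $G$ has one vertex, then $M(G)=2^k/(2k)!$. An edge cut is the set of all edges between $X$ and $V(G)\setminus X$ for some $\emptyset\neq X\subsetneq V(G)$; its sides are $X$ and $V(G)\setminus X$. Theorem. Let $G$ be a $2k$-regular graph. The invariant $M(G)$ is well defined: if $G$ has at least four vertices and no self-loop, then $M(G)=\sum_{\tau\in\mathcal{T}(v)}M(G_\tau)$ holds for every vertex $v$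 of $G$. Moreover: (1) If $G$ has an edge cut of size less than $2k$, then $M(G)=0$. (2) If $G$ has no edge cut of size less than $2k$, then $M(G)>0$. (3) If $G$ has an edge cut of size equal to $2k$, then $M(G)=k!\cdot M(G_1)\cdot M(G_2)$, where $G_1$ and $G_2$ are obtained from $G$ by replacing one or the other side of the cut with a single vertex: the edges inside that side are deleted, and each edge of the cut is attached to the new vertex instead of its end in that side. -/

import Mathlib

/-- A perfect matching of (the elements of) a type, as the map sending each element to its partner:
an involution without fixed points. -/
def PerfectMatching (α : Type*) : Type _ :=
  {m : α → α // (∀ a, m (m a) = a) ∧ ∀ a, m a ≠ a}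

namespace PerfectMatching

/-- The partner of an element. -/
def mate {α : Type*} (m : PerfectMatching α) : α → α := m.1

theorem mate_mate {α : Type*} (m : PerfectMatching α) (a : α) : m.mate (m.mate a) = a := m.2.1 a

theorem mate_ne {α : Type*} (m : PerfectMatching α) (a : α) : m.mate a ≠ a := m.2.2 a

noncomputable instance {α : Type*} [Finite α] : Fintype (PerfectMatching α) :=
  haveI : Finite (PerfectMatching α) :=
    inferInstanceAs (Finite {m : α → α // (∀ a, m (m a) = a) ∧ ∀ a, m a ≠ a})
  Fintype.ofFinite _

end PerfectMatching

/-- An undirected graph with vertex set `V` and set of half-edges `H`; multiple edges and self-loops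
are allowed. Each half-edge is incident with exactly one vertex, and the edges are the pairs of a
perfect matching of the half-edges. -/
structure Multigraph (V H : Type*) where
  /-- The vertex with which a half-edge is incident. -/
  vert : H → V
  /-- The perfect matching of the half-edges given by the edges. -/
  edges : PerfectMatching H

namespace Multigraph

variable {V H : Type*}

/-- The other half of the edge containing the half-edge `h`. -/
def opp (G : Multigraph V H) (h : H) : H := G.edges.mate h

theorem opp_opp (G : Multigraph V H) (h : H) : G.opp (G.opp h) = h := G.edges.mate_mate h

theorem opp_ne (G : Multigraph V H) (h : H) : G.opp h ≠ h := G.edges.mate_ne h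

/-- The degree of a vertex: the number of half-edges incident with it, so that a self-loop counts
twice. -/
noncomputable def degree (G : Multigraph V H) (v : V) : ℕ := Nat.card {h : H // G.vert h = v}

def IsRegular (G : Multigraph V H) (d : ℕ) : Prop := ∀ v, G.degree v = d

def HasSelfLoopAt (G : Multigraph V H) (v : V) : Prop := ∃ h, G.vert h = v ∧ G.vert (G.opp h) = v

def HasSelfLoop (G : Multigraph V H) : Prop := ∃ v, G.HasSelfLoopAt v

/-- A transition at `v`: a perfect matching of the other halves of the half-edges at `v`. -/
abbrev Transition (G : Multigraph V H) (v : V) : Type _ :=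
  PerfectMatching {h : H // G.vert (G.opp h) = v}

open Classical in
/-- For a vertex `v` without self-loops and a transition `τ` at `v`, the graph `G_τ`: the vertex `v`
and the half-edges at `v` are removed, and their other halves are matched into new edges according
to `τ`. -/
noncomputable def resolve (G : Multigraph V H) (v : V) (hv : ¬ G.HasSelfLoopAt v)
    (τ : G.Transition v) : Multigraph {w : V // w ≠ v} {h : H // G.vert h ≠ v} where
  vert h := ⟨G.vert h.1, h.2⟩
  edges :=
    ⟨fun h =>
      if hh : G.vert (G.opp h.1) = v then
        ⟨(τ.mate ⟨h.1, hh⟩).1, fun h' => hv ⟨_, h', (τ.mate ⟨h.1, hh⟩).2⟩⟩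
      else ⟨G.opp h.1, hh⟩, by
      constructor
      · rintro ⟨h, hh⟩
        by_cases h1 : G.vert (G.opp h) = v
        · have h2 := (τ.mate ⟨h, h1⟩).2
          simp [h1, h2, τ.mate_mate]
        · simp [h1, G.opp_opp, hh]
      · rintro ⟨h, hh⟩ e
        by_cases h1 : G.vert (G.opp h) = v
        · simp only [h1, dite_true, Subtype.mk.injEq] at e
          exact τ.mate_ne ⟨h, h1⟩ (Subtype.ext e)
        · simp only [h1, dite_false, Subtype.mk.injEq] at e
          exact G.opp_ne h e⟩

open Classical in
/-- Auxiliary recursion for `martin`, to be used with `n` the number of vertices. -/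
noncomputable def martinAux (k : ℕ) :
    (n : ℕ) → {V : Type*} → {H : Type*} → [Finite V] → [Finite H] → Multigraph V H → ℚ
  | 0, _, _, _, _, _ => 0
  | 1, _, _, _, _, _ => 2 ^ k / (2 * k).factorial
  | 2, _, _, _, _, G => if G.HasSelfLoop then 0 else 1 / k.factorial
  | 3, _, _, _, _, G => if G.HasSelfLoop then 0 else 1
  | n + 4, V, _, _, _, G =>
    if hG : G.HasSelfLoop then 0
    else if hV : Nonempty V then
      ∑ τ : G.Transition hV.some,
        martinAux k (n + 3) (G.resolve hV.some (fun h => hG ⟨_, h⟩) τ)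
    else 0

/-- The Martin invariant of a `2k`-regular graph `G` with at least one vertex.

With at least three vertices: it is `0` if `G` has a self-loop, it is `1` if `G` has three vertices
and no self-loop, and otherwise it is the sum of the Martin invariants of `G_τ` over all transitions
`τ` at some vertex (the result does not depend on the vertex).

With two vertices it is `0` if there is a self-loop and `1 / k!` for the `2k`-fold edge, and for the
graph with one vertex and `k` self-loops it is `2 ^ k / (2k)!`. -/
noncomputable def martin [Finite V] [Finite H] (k : ℕ) (G : Multigraph V H) : ℚ :=
  martinAux k (Nat.card V) G

/-- The size of the edge cut between `X` and its complement: the number of edges with one end in `X`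
and the other end outside, each counted through its half in `X`. -/
noncomputable def cutSize (G : Multigraph V H) (X : Set V) : ℕ :=
  Nat.card {h : H // G.vert h ∈ X ∧ G.vert (G.opp h) ∉ X}

/-- `X` is one of the two sides of an edge cut of size `s`; both sides are non-empty. -/
def IsEdgeCut (G : Multigraph V H) (X : Set V) (s : ℕ) : Prop :=
  X.Nonempty ∧ Xᶜ.Nonempty ∧ G.cutSize X = s

open Classical in
/-- The graph obtained from `G` by replacing the complement of `X` with a single vertex `none`:
edges inside `X` are kept, an edge between `X` and its complement becomes an edge between its end in
`X` and `none`, and edges inside the complement are deleted. -/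
noncomputable def replaceCompl (G : Multigraph V H) (X : Set V) :
    Multigraph (Option X) {h : H // G.vert h ∈ X ∨ G.vert (G.opp h) ∈ X} where
  vert h := if hh : G.vert h.1 ∈ X then some ⟨G.vert h.1, hh⟩ else none
  edges :=
    ⟨fun h => ⟨G.opp h.1, by rw [G.opp_opp]; exact h.2.symm⟩,
      fun h => Subtype.ext (G.opp_opp h.1),
      fun h e => G.opp_ne h.1 (congrArg Subtype.val e)⟩

end Multigraph

/-! Well-definedness goes by induction on the number of vertices. For two vertices `v` and `w`,
expanding at `v` and then at `w` gives a sum over matchings `π` of the half-edges at the remaining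
vertices; the coefficient of `π` is the number of transitions at `v` compatible with `π` that create
no self-loop at `w` (`sum_resolve_resolve`). This number is symmetric in `v` and `w`: both have the
same degree, and as many pairs of `π` link a neighbour of `v` to one of `w` as conversely, so the
half-edges around `v` and around `w` correspond compatibly with `π` (`card_transition_swap`). The
induction starts at three vertices and carries isomorphism invariance along.

(1) Resolving a vertex does not enlarge any cut, so a small cut persists until a self-loop appears
(`martin_eq_zero_of_cutSize_lt`).

(2) All terms of the recursion are non-negative, and one is positive: by a splitting-off argument in
the manner of Lovász, some transition keeps all cuts at size at least `2k`
(`exists_complete_splitting`). It rests on submodularity of cuts and on their parity.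

(3) Expand both sides at a vertex `v` of `X` (`martin_eq_mul`). Transitions at `v` in `G` and in
`G.replaceCompl X` are the same. If no two cut edges are paired, the cut keeps its size and
induction applies; otherwise the cut becomes too small on the left and the new vertex gets a
self-loop on the right, so both terms vanish. If `X = {v}`, one factor is `1 / k!` and the other
graph is isomorphic to `G`. -/

namespace PerfectMatching

variable {α β : Type*}

/-! ### Transport of perfect matchings. -/

theorem ext_mate {m m' : PerfectMatching α} (h : ∀ a, m.mate a = m'.mate a) : m = m' :=
  Subtype.ext (funext h)

/-- Transport of a perfect matching along a bijection. -/
def congr (e : α ≃ β) : PerfectMatching α ≃ PerfectMatching β where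
  toFun m := ⟨fun b => e (m.mate (e.symm b)), fun b => by simp [m.mate_mate],
    fun b h => m.mate_ne (e.symm b) (e.injective (by simpa using h))⟩
  invFun m := ⟨fun a => e.symm (m.mate (e a)), fun a => by simp [m.mate_mate],
    fun a h => m.mate_ne (e a) (e.symm.injective (by simpa using h))⟩
  left_inv m := ext_mate fun a => by simp [mate]
  right_inv m := ext_mate fun a => by simp [mate]

theorem congr_mate (e : α ≃ β) (m : PerfectMatching α) (a : α) :
    (congr e m).mate (e a) = e (m.mate a) :=
  congrArg (fun x => e (m.mate x)) (e.symm_apply_apply a)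

end PerfectMatching

namespace Multigraph

universe u v

variable {V V' : Type u} {H H' : Type v}

/-! ### Half-edges of a resolution -/

theorem resolve_vert (G : Multigraph V H) (v : V) (hv : ¬ G.HasSelfLoopAt v) (τ : G.Transition v)
    (h : {h : H // G.vert h ≠ v}) : ((G.resolve v hv τ).vert h).1 = G.vert h.1 := rfl

theorem resolve_opp_of_ne (G : Multigraph V H) (v : V) (hv : ¬ G.HasSelfLoopAt v)
    (τ : G.Transition v) (h : {h : H // G.vert h ≠ v}) (hh : G.vert (G.opp h.1) ≠ v) :
    ((G.resolve v hv τ).opp h).1 = G.opp h.1 := by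
  have : ¬ G.vert (G.edges.1 h.1) = v := hh
  simp [resolve, opp, PerfectMatching.mate, this]

theorem resolve_opp_of_eq (G : Multigraph V H) (v : V) (hv : ¬ G.HasSelfLoopAt v)
    (τ : G.Transition v) (h : {h : H // G.vert h ≠ v}) (hh : G.vert (G.opp h.1) = v) :
    ((G.resolve v hv τ).opp h).1 = (τ.mate ⟨h.1, hh⟩).1 := by
  have : G.vert (G.edges.1 h.1) = v := hh
  simp [resolve, opp, PerfectMatching.mate, this]

theorem resolve_isRegular {G : Multigraph V H} {d : ℕ} (hG : G.IsRegular d) (v : V)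
    (hv : ¬ G.HasSelfLoopAt v) (τ : G.Transition v) : (G.resolve v hv τ).IsRegular d := by
  rintro ⟨w, hw⟩
  rw [← hG w]
  refine Nat.card_congr
    { toFun := fun h => ⟨h.1.1, congrArg Subtype.val h.2⟩
      invFun := fun h => ⟨⟨h.1, fun e => hw (h.2.symm.trans e)⟩, Subtype.ext h.2⟩
      left_inv := fun h => rfl
      right_inv := fun h => rfl }

theorem hasSelfLoopAt_resolve {G : Multigraph V H} {v w : V} (hv : ¬ G.HasSelfLoopAt v)
    (τ : G.Transition v) (hw : w ≠ v) (h : G.HasSelfLoopAt w) :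
    (G.resolve v hv τ).HasSelfLoopAt ⟨w, hw⟩ := by
  obtain ⟨x, hx, hx'⟩ := h
  refine ⟨⟨x, hx ▸ hw⟩, Subtype.ext hx, Subtype.ext ?_⟩
  rw [resolve_vert, resolve_opp_of_ne _ _ _ _ _ (hx' ▸ hw)]
  exact hx'

theorem card_ne [Finite V] (v : V) : Nat.card {w : V // w ≠ v} = Nat.card V - 1 := by
  classical
  have := Fintype.ofFinite V
  rw [Nat.card_eq_fintype_card, Nat.card_eq_fintype_card, Fintype.card_subtype_compl,
    Fintype.card_subtype_eq]

/-- The number of half-edges whose other half is at `v`. -/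
theorem card_opp_eq (G : Multigraph V H) (v : V) :
    Nat.card {h : H // G.vert (G.opp h) = v} = G.degree v := by
  refine Nat.card_congr
    { toFun := fun h => ⟨G.opp h.1, h.2⟩
      invFun := fun h => ⟨G.opp h.1, by rw [G.opp_opp]; exact h.2⟩
      left_inv := fun h => Subtype.ext (G.opp_opp _)
      right_inv := fun h => Subtype.ext (G.opp_opp _) }

/-! ### Isomorphisms -/

/-- An isomorphism of multigraphs. -/
structure Iso (G : Multigraph V H) (G' : Multigraph V' H') where
  onV : V ≃ V'
  onH : H ≃ H'
  vert_onH : ∀ h, G'.vert (onH h) = onV (G.vert h)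
  opp_onH : ∀ h, G'.opp (onH h) = onH (G.opp h)

namespace Iso

variable {G : Multigraph V H} {G' : Multigraph V' H'}

theorem hasSelfLoopAt_iff (f : Iso G G') (v : V) :
    G'.HasSelfLoopAt (f.onV v) ↔ G.HasSelfLoopAt v := by
  constructor
  · rintro ⟨h, h1, h2⟩
    obtain ⟨x, rfl⟩ := f.onH.surjective h
    rw [f.vert_onH] at h1
    rw [f.opp_onH, f.vert_onH] at h2
    exact ⟨x, f.onV.injective h1, f.onV.injective h2⟩
  · rintro ⟨h, h1, h2⟩
    exact ⟨f.onH h, by rw [f.vert_onH, h1], by rw [f.opp_onH, f.vert_onH, h2]⟩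

theorem hasSelfLoop_iff (f : Iso G G') : G'.HasSelfLoop ↔ G.HasSelfLoop := by
  constructor
  · rintro ⟨v, hv⟩
    obtain ⟨x, rfl⟩ := f.onV.surjective v
    exact ⟨x, (f.hasSelfLoopAt_iff x).1 hv⟩
  · rintro ⟨v, hv⟩
    exact ⟨f.onV v, (f.hasSelfLoopAt_iff v).2 hv⟩

/-- The bijection between half-edges opposite to corresponding vertices. -/
def oppEquiv (f : Iso G G') (v : V) :
    {h : H // G.vert (G.opp h) = v} ≃ {h : H' // G'.vert (G'.opp h) = f.onV v} :=
  f.onH.subtypeEquiv fun h => by rw [f.opp_onH, f.vert_onH, f.onV.injective.eq_iff]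

/-- Corresponding resolutions of isomorphic multigraphs are isomorphic. -/
noncomputable def resolve (f : Iso G G') (v : V) (hv : ¬ G.HasSelfLoopAt v)
    (hv' : ¬ G'.HasSelfLoopAt (f.onV v)) (τ : G.Transition v) :
    Iso (G.resolve v hv τ)
      (G'.resolve (f.onV v) hv' (PerfectMatching.congr (f.oppEquiv v) τ)) where
  onV := f.onV.subtypeEquiv fun w => by rw [f.onV.injective.ne_iff]
  onH := f.onH.subtypeEquiv fun h => by rw [f.vert_onH, f.onV.injective.ne_iff]
  vert_onH h := Subtype.ext (f.vert_onH h.1)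
  opp_onH := by
    intro h
    apply Subtype.ext
    by_cases hh : G.vert (G.opp h.1) = v
    · have h2 : G'.vert (G'.opp (f.onH h.1)) = f.onV v := by rw [f.opp_onH, f.vert_onH, hh]
      rw [resolve_opp_of_eq _ _ _ _ _ h2]
      have := congrArg Subtype.val (PerfectMatching.congr_mate (f.oppEquiv v) τ ⟨h.1, hh⟩)
      refine this.trans ?_
      simp [oppEquiv, Equiv.subtypeEquiv_apply, resolve_opp_of_eq _ _ _ _ _ hh]
    · have h2 : G'.vert (G'.opp (f.onH h.1)) ≠ f.onV v := by
        rwa [f.opp_onH, f.vert_onH, f.onV.injective.ne_iff]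
      rw [resolve_opp_of_ne _ _ _ _ _ h2]
      simp [Equiv.subtypeEquiv_apply, resolve_opp_of_ne _ _ _ _ _ hh, f.opp_onH]

end Iso

open Classical in
/-- Two multigraphs are isomorphic if they correspond to each other away from a vertex without
self-loops. -/
noncomputable def Iso.ofAway {G : Multigraph V H} {G' : Multigraph V' H'} {x : V} {x' : V'}
    (hx : ¬ G.HasSelfLoopAt x) (hx' : ¬ G'.HasSelfLoopAt x') (eV : V ≃ V') (hxx : eV x = x')
    (eH : {h : H // G.vert h ≠ x} ≃ {h : H' // G'.vert h ≠ x'})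
    (hvert : ∀ h, G'.vert (eH h).1 = eV (G.vert h.1))
    (hopp : ∀ h, G.vert (G.opp h.1) = x → G'.vert (G'.opp (eH h).1) = x')
    (hopp' : ∀ h (hh : G.vert (G.opp h.1) ≠ x), G'.opp (eH h).1 = (eH ⟨G.opp h.1, hh⟩).1) :
    Iso G G' :=
  have hne : ∀ h, G.vert h = x → G.vert (G.opp h) ≠ x := fun h h1 h2 => hx ⟨h, h1, h2⟩
  have hne' : ∀ h, G'.vert h = x' → G'.vert (G'.opp h) ≠ x' := fun h h1 h2 => hx' ⟨h, h1, h2⟩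
  have hoppi : ∀ h, G'.vert (G'.opp (eH h).1) = x' → G.vert (G.opp h.1) = x := fun h h1 => by
    by_contra h2
    rw [hopp' h h2] at h1
    exact (eH _).2 h1
  have hopps : ∀ h, G'.vert (G'.opp h.1) = x' → G.vert (G.opp (eH.symm h).1) = x := fun h h1 =>
    hoppi _ (by simpa using h1)
  { onV := eV
    -- A half-edge at `x` is carried over through its other half, which is not at `x` as there is no
    -- self-loop there.
    onH :=
      { toFun := fun h => if hh : G.vert h = x then G'.opp (eH ⟨G.opp h, hne h hh⟩).1
          else (eH ⟨h, hh⟩).1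
        invFun := fun h => if hh : G'.vert h = x' then G.opp (eH.symm ⟨G'.opp h, hne' h hh⟩).1
          else (eH.symm ⟨h, hh⟩).1
        left_inv := by
          intro h
          by_cases hh : G.vert h = x
          · have : G'.vert (G'.opp (eH ⟨G.opp h, hne h hh⟩).1) = x' :=
              hopp _ (by rw [G.opp_opp]; exact hh)
            simp [hh, this, G.opp_opp, G'.opp_opp]
          · have := (eH ⟨h, hh⟩).2
            simp [hh, this]
        right_inv := by
          intro h
          by_cases hh : G'.vert h = x'
          · have : G.vert (G.opp (eH.symm ⟨G'.opp h, hne' h hh⟩).1) = x :=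
              hopps _ (by rw [G'.opp_opp]; exact hh)
            simp [hh, this, G.opp_opp, G'.opp_opp]
          · have := (eH.symm ⟨h, hh⟩).2
            simp [hh, this] }
    vert_onH := by
      intro h
      by_cases hh : G.vert h = x
      · simp only [Equiv.coe_fn_mk, hh, dite_true, hxx]
        exact hopp _ (by rw [G.opp_opp]; exact hh)
      · simp only [Equiv.coe_fn_mk, hh, dite_false, hvert]
    opp_onH := by
      intro h
      by_cases hh : G.vert h = x
      · have := hne h hh
        simp [hh, this, G'.opp_opp]
      · by_cases h2 : G.vert (G.opp h) = x
        · simp [hh, h2, G.opp_opp]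
        · simp [hh, h2, hopp' ⟨h, hh⟩ h2] }

/-! ### Cuts -/

theorem cutSize_compl (G : Multigraph V H) (X : Set V) : G.cutSize Xᶜ = G.cutSize X := by
  refine Nat.card_congr
    { toFun := fun h => ⟨G.opp h.1, by simpa using h.2.2, by rw [G.opp_opp]; exact h.2.1⟩
      invFun := fun h => ⟨G.opp h.1, h.2.2, by rw [G.opp_opp]; simpa using h.2.1⟩
      left_inv := fun h => Subtype.ext (G.opp_opp _)
      right_inv := fun h => Subtype.ext (G.opp_opp _) }

theorem cutSize_singleton (G : Multigraph V H) {v : V} (hv : ¬ G.HasSelfLoopAt v) :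
    G.cutSize {v} = G.degree v :=
  Nat.card_congr (Equiv.subtypeEquivRight fun h =>
    ⟨fun hh => hh.1, fun hh => ⟨hh, fun h' => hv ⟨h, hh, h'⟩⟩⟩)

/-- A half of a self-loop counts for the degree but not for the cut. Thus a bound `2k` on all cuts
excludes self-loops once there are two vertices. -/
theorem cutSize_singleton_lt [Finite H] (G : Multigraph V H) {v : V} (hv : G.HasSelfLoopAt v) :
    G.cutSize {v} < G.degree v := by
  obtain ⟨x, h1, h2⟩ := hv
  have : {h | G.vert h ∈ ({v} : Set V) ∧ G.vert (G.opp h) ∉ ({v} : Set V)} ⊂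
      {h | G.vert h = v} := by
    refine ⟨fun h hh => hh.1, fun hs => (hs h1).2 h2⟩
  exact Set.ncard_lt_ncard this (Set.toFinite _)

/-- The part of `X` that is left after deletion of `v`. -/
def restrict (X : Set V) (v : V) : Set {w : V // w ≠ v} := {w | w.1 ∈ X}

theorem restrict_compl (X : Set V) (v : V) : restrict Xᶜ v = (restrict X v)ᶜ := rfl

theorem mem_of_resolve_cut {G : Multigraph V H} {v : V} {hv : ¬ G.HasSelfLoopAt v}
    {τ : G.Transition v} {X : Set V} (hX : v ∉ X) {h : {h : H // G.vert h ≠ v}}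
    (hh : (G.resolve v hv τ).vert ((G.resolve v hv τ).opp h) ∉ restrict X v) :
    G.vert (G.opp h.1) ∉ X := by
  intro h1
  have h2 : G.vert (G.opp h.1) ≠ v := fun e => hX (e ▸ h1)
  apply hh
  change ((G.resolve v hv τ).vert ((G.resolve v hv τ).opp h)).1 ∈ X
  rwa [resolve_vert, resolve_opp_of_ne _ _ _ _ _ h2]

/-- A half-edge in `X` that gets a new partner was joined to `v`, outside `X`, and so was in the cut
before. Hence the cut half-edges of the resolution inject into those of `G`. -/
theorem cutSize_resolve_le_of_notMem [Finite H] (G : Multigraph V H) {v : V}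
    (hv : ¬ G.HasSelfLoopAt v) (τ : G.Transition v) {X : Set V} (hX : v ∉ X) :
    (G.resolve v hv τ).cutSize (restrict X v) ≤ G.cutSize X := by
  refine Nat.card_le_card_of_injective
    (fun h => (⟨h.1.1, h.2.1, mem_of_resolve_cut hX h.2.2⟩ :
      {h : H // G.vert h ∈ X ∧ G.vert (G.opp h) ∉ X})) ?_
  intro a b hab
  have : a.1.1 = b.1.1 := congrArg (fun z => z.1) hab
  exact Subtype.ext (Subtype.ext this)

theorem cutSize_resolve_le [Finite H] (G : Multigraph V H) {v : V}
    (hv : ¬ G.HasSelfLoopAt v) (τ : G.Transition v) (X : Set V) :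
    (G.resolve v hv τ).cutSize (restrict X v) ≤ G.cutSize X := by
  by_cases hX : v ∈ X
  · rw [← cutSize_compl, ← cutSize_compl G]
    exact cutSize_resolve_le_of_notMem G hv τ (X := Xᶜ) (fun h => h hX)
  · exact cutSize_resolve_le_of_notMem G hv τ hX

/-! ### Vanishing and non-negativity -/

theorem martin_eq_zero_of_hasSelfLoop [Finite V] [Finite H] (k : ℕ) {G : Multigraph V H}
    (hG : G.HasSelfLoop) (hV : 2 ≤ Nat.card V) : G.martin k = 0 := by
  unfold martin
  obtain ⟨n, hn⟩ := Nat.exists_eq_add_of_le' hV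
  rw [hn]
  match n with
  | 0 => simp [martinAux, hG]
  | 1 => simp [martinAux, hG]
  | n + 2 => simp [martinAux, hG]

theorem martin_of_card_two [Finite V] [Finite H] (k : ℕ) {G : Multigraph V H}
    (hG : ¬ G.HasSelfLoop) (hV : Nat.card V = 2) : G.martin k = 1 / k.factorial := by
  unfold martin
  rw [hV]
  simp [martinAux, hG]

theorem martin_of_card_three [Finite V] [Finite H] (k : ℕ) {G : Multigraph V H}
    (hG : ¬ G.HasSelfLoop) (hV : Nat.card V = 3) : G.martin k = 1 := by
  unfold martin
  rw [hV]
  simp [martinAux, hG]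

theorem martin_of_card_one [Finite V] [Finite H] (k : ℕ) (G : Multigraph V H)
    (hV : Nat.card V = 1) : G.martin k = 2 ^ k / (2 * k).factorial := by
  unfold martin
  rw [hV]
  simp [martinAux]

/-- The recursion holds at some vertex, by definition. -/
theorem exists_martin_eq_sum [Finite V] [Finite H] (k : ℕ) {G : Multigraph V H}
    (hG : ¬ G.HasSelfLoop) (hV : 4 ≤ Nat.card V) :
    ∃ v, G.martin k = ∑ τ : G.Transition v, (G.resolve v (fun h => hG ⟨v, h⟩) τ).martin k := by
  have hne : Nonempty V := (Nat.card_pos_iff.1 (by omega)).1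
  refine ⟨hne.some, ?_⟩
  obtain ⟨n, hn⟩ := Nat.exists_eq_add_of_le' hV
  have h1 : ∀ v : V, Nat.card {w : V // w ≠ v} = n + 3 := fun v => by rw [card_ne, hn]; rfl
  unfold martin
  simp only [h1]
  rw [hn, martinAux]
  simp [hG, hne]

theorem martinAux_nonneg (k n : ℕ) : ∀ {V : Type u} {H : Type v} [Finite V] [Finite H]
    (G : Multigraph V H), 0 ≤ martinAux k n G := by
  induction n using Nat.strong_induction_on with
  | _ n ih =>
    intro V H _ _ G
    match n with
    | 0 => simp [martinAux]
    | 1 => simp only [martinAux]; positivity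
    | 2 => simp only [martinAux]; split_ifs <;> positivity
    | 3 => simp only [martinAux]; split_ifs <;> norm_num
    | n + 4 =>
      rw [martinAux]
      split_ifs
      · rfl
      · exact Finset.sum_nonneg fun τ _ => ih (n + 3) (by omega) _
      · rfl

theorem martin_nonneg [Finite V] [Finite H] (k : ℕ) (G : Multigraph V H) : 0 ≤ G.martin k :=
  martinAux_nonneg k _ G

/-- The small cut survives every resolution, so all terms of the recursion vanish by induction. -/
theorem martin_eq_zero_of_cutSize_lt (k n : ℕ) : ∀ {V : Type u} {H : Type v} [Finite V] [Finite H]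
    (G : Multigraph V H), Nat.card V = n → G.IsRegular (2 * k) → ∀ X : Set V, X.Nonempty →
    Xᶜ.Nonempty → G.cutSize X < 2 * k → G.martin k = 0 := by
  induction n with
  | zero =>
    intro V H _ _ G hn hG X ⟨x, _⟩
    have := Nat.card_pos_iff.2 ⟨⟨x⟩, (inferInstance : Finite V)⟩
    omega
  | succ n ih =>
    intro V H _ _ G hn hG X hX hXc hlt
    have h2 : 2 ≤ Nat.card V := by
      obtain ⟨x, hx⟩ := hX
      obtain ⟨y, hy⟩ := hXc
      have : Nontrivial V := ⟨x, y, fun e => hy (e ▸ hx)⟩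
      exact Finite.one_lt_card
    by_cases hl : G.HasSelfLoop
    · exact martin_eq_zero_of_hasSelfLoop k hl h2
    have hl' : ∀ v, ¬ G.HasSelfLoopAt v := fun v h => hl ⟨v, h⟩
    -- Without self-loops a single vertex has a cut of size exactly `2k`. So both sides have at
    -- least two vertices and stay non-empty after any deletion.
    have hs : ∀ v, X ≠ {v} := by
      rintro v rfl
      rw [cutSize_singleton G (hl' v), hG v] at hlt
      exact lt_irrefl _ hlt
    have hsc : ∀ v, Xᶜ ≠ {v} := by
      intro v hv
      rw [← cutSize_compl, hv, cutSize_singleton G (hl' v), hG v] at hlt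
      exact lt_irrefl _ hlt
    have key : ∀ (Y : Set V) (v : V), Y.Nonempty → Y ≠ {v} → (restrict Y v).Nonempty := by
      rintro Y v hY h1
      by_contra h
      apply h1
      refine Set.eq_singleton_iff_nonempty_unique_mem.2 ⟨hY, fun y hy => ?_⟩
      by_contra hyv
      exact h ⟨⟨y, hyv⟩, hy⟩
    by_cases h4 : 4 ≤ Nat.card V
    · obtain ⟨v, hv⟩ := exists_martin_eq_sum k hl h4
      rw [hv]
      refine Finset.sum_eq_zero fun τ _ => ?_
      refine ih _ (by rw [card_ne]; omega) (resolve_isRegular hG _ _ _) (restrict X v)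
        (key X v hX (hs v)) (by rw [← restrict_compl]; exact key _ v hXc (hsc v)) ?_
      exact (cutSize_resolve_le G _ τ X).trans_lt hlt
    -- Two sides with at least two vertices each need four vertices.
    · exfalso
      have h1 : 1 < X.ncard := by
        rw [Set.one_lt_ncard_iff_nontrivial]
        obtain ⟨x, hx⟩ := hX
        by_contra h
        exact hs x ((Set.not_nontrivial_iff.1 h).eq_singleton_of_mem hx)
      have h2 : 1 < Xᶜ.ncard := by
        rw [Set.one_lt_ncard_iff_nontrivial]
        obtain ⟨x, hx⟩ := hXc
        by_contra h
        exact hsc x ((Set.not_nontrivial_iff.1 h).eq_singleton_of_mem hx)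
      have := Set.ncard_add_ncard_compl X
      omega

end Multigraph

/-! ### Conjugacy of involutions. -/

namespace PerfectMatching

/-- Involutions of sets of the same size with the same number of fixed points are conjugate. -/
theorem exists_equiv_semiconj {α β : Type*} [Finite α] [Finite β] {f : α → α} {g : β → β}
    (hf : Function.Involutive f) (hg : Function.Involutive g) (hcard : Nat.card α = Nat.card β)
    (hfix : Nat.card {a // f a = a} = Nat.card {b // g b = b}) :
    ∃ e : α ≃ β, ∀ a, e (f a) = g (e a) := by
  classical
  have := Fintype.ofFinite α
  have := Fintype.ofFinite β
  have e₀ : α ≃ β := Fintype.equivOfCardEq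
    (by rwa [Nat.card_eq_fintype_card, Nat.card_eq_fintype_card] at hcard)
  -- The cycles of an involution have length two, so its cycle type depends only on the size of the
  -- support.
  have type : ∀ σ : Equiv.Perm α, σ * σ = 1 →
      σ.cycleType = Multiset.replicate (σ.support.card / 2) 2 := by
    intro σ hσ
    have h2 : σ.cycleType = Multiset.replicate (Multiset.card σ.cycleType) 2 := by
      refine Multiset.eq_replicate_card.2 fun n hn => ?_
      have h1 := Equiv.Perm.dvd_of_mem_cycleType hn
      have h3 := Equiv.Perm.two_le_of_mem_cycleType hn
      have h4 : orderOf σ ∣ 2 := orderOf_dvd_of_pow_eq_one (by rw [pow_two, hσ])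
      have := Nat.le_of_dvd (by norm_num) (h1.trans h4)
      omega
    have h3 := σ.sum_cycleType
    rw [h2, Multiset.sum_replicate, smul_eq_mul] at h3
    rw [← h3, Nat.mul_div_cancel _ (by norm_num)]
    exact h2
  have supp : ∀ σ : Equiv.Perm α, σ.support.card + Nat.card {a // σ a = a} = Nat.card α := by
    intro σ
    rw [Nat.card_eq_fintype_card, Nat.card_eq_fintype_card, Fintype.card_subtype,
      Equiv.Perm.support, add_comm]
    exact Finset.card_filter_add_card_filter_not _
  let σ : Equiv.Perm α := hf.toPerm
  let ρ : Equiv.Perm α := (e₀.trans hg.toPerm).trans e₀.symm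
  have hσ : σ * σ = 1 := Equiv.ext fun a => hf a
  have hρ : ρ * ρ = 1 := Equiv.ext fun a => by simp [ρ, hg (e₀ a)]
  have hσf : Nat.card {a // σ a = a} = Nat.card {a // f a = a} := rfl
  have hρf : Nat.card {a // ρ a = a} = Nat.card {b // g b = b} :=
    Nat.card_congr (e₀.subtypeEquiv fun a => by simp [ρ, Equiv.symm_apply_eq])
  have hc : IsConj σ ρ := by
    rw [Equiv.Perm.isConj_iff_cycleType_eq, type σ hσ, type ρ hρ]
    have h1 := supp σ
    have h2 := supp ρ
    rw [show σ.support.card = ρ.support.card by omega]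
  obtain ⟨c, hc⟩ := isConj_iff.1 hc
  refine ⟨c.trans e₀, fun a => ?_⟩
  have h1 : c (σ a) = ρ (c a) := by rw [← hc]; simp
  have h2 : c (f a) = ρ (c a) := h1
  simp [h2, ρ]

end PerfectMatching

namespace Multigraph

universe u v

variable {V V' : Type u} {H H' : Type v}

/-! ### Resolving two vertices -/

/-- Transitions at `v` correspond to matchings of the half-edges away from `v` which keep the edges
away from `v`. -/
noncomputable def transitionEquiv (G : Multigraph V H) (v : V) (hv : ¬ G.HasSelfLoopAt v) :
    G.Transition v ≃ {π : PerfectMatching {h : H // G.vert h ≠ v} //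
      ∀ h, G.vert (G.opp h.1) ≠ v → (π.mate h).1 = G.opp h.1} where
  toFun τ := ⟨(G.resolve v hv τ).edges, fun h hh => resolve_opp_of_ne G v hv τ h hh⟩
  invFun π :=
    have hne : ∀ h, G.vert (G.opp h) = v → G.vert h ≠ v := fun h h1 h2 => hv ⟨h, h2, h1⟩
    have hmem : ∀ h : {h : H // G.vert h ≠ v}, G.vert (G.opp h.1) = v →
        G.vert (G.opp (π.1.mate h).1) = v := fun h h1 => by
      by_contra h2
      have h3 := π.2 _ h2
      rw [π.1.mate_mate] at h3
      rw [h3, G.opp_opp] at h1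
      exact (π.1.mate h).2 h1
    ⟨fun h => ⟨(π.1.mate ⟨h.1, hne _ h.2⟩).1, hmem _ h.2⟩,
      fun h => Subtype.ext (congrArg Subtype.val (π.1.mate_mate ⟨h.1, hne _ h.2⟩) :),
      fun h e => π.1.mate_ne ⟨h.1, hne _ h.2⟩ (Subtype.ext (congrArg Subtype.val e :))⟩
  left_inv τ := by
    refine PerfectMatching.ext_mate fun h => Subtype.ext ?_
    exact resolve_opp_of_eq G v hv τ ⟨h.1, _⟩ h.2
  right_inv π := by
    refine Subtype.ext (PerfectMatching.ext_mate fun h => Subtype.ext ?_)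
    by_cases hh : G.vert (G.opp h.1) = v
    · exact resolve_opp_of_eq G v hv _ h hh
    · exact (resolve_opp_of_ne G v hv _ h hh).trans (π.2 h hh).symm

/-- The multigraph on the vertices in `U` whose edges are given by a matching of the half-edges
at `U`. -/
def onSet (G : Multigraph V H) (U : Set V) (π : PerfectMatching {h : H // G.vert h ∈ U}) :
    Multigraph U {h : H // G.vert h ∈ U} where
  vert h := ⟨G.vert h.1, h.2⟩
  edges := π

/-- A matching `π` of the half-edges at `U` keeps the edges of `G` between vertices of `U`. -/
def Keeps (G : Multigraph V H) (U : Set V) (π : PerfectMatching {h : H // G.vert h ∈ U}) : Prop :=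
  ∀ h, G.vert (G.opp h.1) ∈ U → (π.mate h).1 = G.opp h.1

/-- A matching `π` of the half-edges at `U` contains the pairs at `U` of the transition `τ`. -/
def Extends (G : Multigraph V H) (U : Set V) (π : PerfectMatching {h : H // G.vert h ∈ U}) {v : V}
    (τ : G.Transition v) : Prop :=
  ∀ a, G.vert (τ.mate a).1 ∈ U → ∀ ha : G.vert a.1 ∈ U, (π.mate ⟨a.1, ha⟩).1 = (τ.mate a).1

/-- The transition `τ` creates no self-loop at `w`. -/
def Avoids (G : Multigraph V H) {v : V} (τ : G.Transition v) (w : V) : Prop :=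
  ∀ a, G.vert a.1 = w → G.vert (τ.mate a).1 ≠ w

section

variable {G : Multigraph V H} {v w : V} {U : Set V}

theorem hasSelfLoopAt_resolve_iff (hv : ¬ G.HasSelfLoopAt v) (hw : ¬ G.HasSelfLoopAt w)
    (hvw : w ≠ v) (τ : G.Transition v) :
    (G.resolve v hv τ).HasSelfLoopAt ⟨w, hvw⟩ ↔ ¬ G.Avoids τ w := by
  constructor
  · rintro ⟨h, h1, h2⟩ hτ
    have h1' : G.vert h.1 = w := congrArg Subtype.val h1
    have h2' := congrArg Subtype.val h2
    rw [resolve_vert] at h2'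
    by_cases hh : G.vert (G.opp h.1) = v
    · rw [resolve_opp_of_eq _ _ _ _ _ hh] at h2'
      exact hτ ⟨h.1, hh⟩ h1' h2'
    · rw [resolve_opp_of_ne _ _ _ _ _ hh] at h2'
      exact hw ⟨h.1, h1', h2'⟩
  · intro hτ
    unfold Avoids at hτ
    push Not at hτ
    obtain ⟨a, h1, h2⟩ := hτ
    refine ⟨⟨a.1, h1 ▸ hvw⟩, Subtype.ext h1, Subtype.ext ?_⟩
    rw [resolve_vert, resolve_opp_of_eq _ _ _ _ _ a.2]
    exact h2

/-- The half-edges away from `v` and `w` after resolving `v`. -/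
def awayEquiv (hU : ∀ x, x ∈ U ↔ x ≠ v ∧ x ≠ w) (hv : ¬ G.HasSelfLoopAt v) (hvw : w ≠ v)
    (τ : G.Transition v) :
    {h : {h : H // G.vert h ≠ v} // (G.resolve v hv τ).vert h ≠ ⟨w, hvw⟩} ≃
      {h : H // G.vert h ∈ U} where
  toFun h := ⟨h.1.1, (hU _).2 ⟨h.1.2, fun e => h.2 (Subtype.ext e)⟩⟩
  invFun h := ⟨⟨h.1, ((hU _).1 h.2).1⟩, fun e => ((hU _).1 h.2).2 (congrArg Subtype.val e)⟩
  left_inv _ := rfl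
  right_inv _ := rfl

/-- The edges of `G_τ` away from `w` are the edges of `G` inside `U` and the pairs of `τ` inside
`U`. With `transitionEquiv`, this describes the transitions at `w` in `G_τ` by matchings of the
half-edges at `U`. -/
theorem keeps_resolve_iff (hU : ∀ x, x ∈ U ↔ x ≠ v ∧ x ≠ w) (hv : ¬ G.HasSelfLoopAt v)
    (hvw : w ≠ v) (τ : G.Transition v)
    (π : PerfectMatching {h : {h : H // G.vert h ≠ v} // (G.resolve v hv τ).vert h ≠ ⟨w, hvw⟩}) :
    (∀ h, (G.resolve v hv τ).vert ((G.resolve v hv τ).opp h.1) ≠ ⟨w, hvw⟩ →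
      (π.mate h).1 = (G.resolve v hv τ).opp h.1) ↔
    G.Keeps U (PerfectMatching.congr (awayEquiv hU hv hvw τ) π) ∧
      G.Extends U (PerfectMatching.congr (awayEquiv hU hv hvw τ) π) τ := by
  have hmate : ∀ h, ((PerfectMatching.congr (awayEquiv hU hv hvw τ) π).mate
      (awayEquiv hU hv hvw τ h)).1 = (π.mate h).1.1 := fun h =>
    congrArg Subtype.val (PerfectMatching.congr_mate (awayEquiv hU hv hvw τ) π h)
  constructor
  · intro hπ
    constructor
    · intro h hh
      obtain ⟨x, rfl⟩ := (awayEquiv hU hv hvw τ).surjective h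
      have h1 : G.vert (G.opp x.1.1) ∈ U := hh
      have h2 := resolve_opp_of_ne G v hv τ x.1 ((hU _).1 h1).1
      have h3 := hπ x (fun e => by
        have := congrArg Subtype.val e
        rw [resolve_vert, h2] at this
        exact ((hU _).1 h1).2 this)
      rw [hmate, h3, h2]
      rfl
    · intro a h1 ha
      have h2 := resolve_opp_of_eq G v hv τ ⟨a.1, ((hU _).1 ha).1⟩ a.2
      have h3 := hπ ((awayEquiv hU hv hvw τ).symm ⟨a.1, ha⟩) (fun e => by
        have := congrArg Subtype.val e
        rw [resolve_vert] at this
        exact ((hU _).1 h1).2 ((congrArg G.vert h2).symm.trans this))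
      have h4 := hmate ((awayEquiv hU hv hvw τ).symm ⟨a.1, ha⟩)
      rw [Equiv.apply_symm_apply] at h4
      rw [h4, h3]
      exact h2
  · rintro ⟨hk, he⟩ h hh
    apply Subtype.ext
    rw [← hmate]
    have hh' : G.vert ((G.resolve v hv τ).opp h.1).1 ≠ w := fun e => hh (Subtype.ext e)
    have hmem : G.vert ((G.resolve v hv τ).opp h.1).1 ∈ U :=
      (hU _).2 ⟨((G.resolve v hv τ).opp h.1).2, hh'⟩
    by_cases h1 : G.vert (G.opp h.1.1) = v
    · have h2 := resolve_opp_of_eq G v hv τ h.1 h1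
      rw [h2] at hmem ⊢
      exact he ⟨h.1.1, h1⟩ hmem _
    · have h2 := resolve_opp_of_ne G v hv τ h.1 h1
      rw [h2] at hmem ⊢
      exact hk _ hmem

/-- Resolving two vertices in turn amounts to choosing a new matching of the remaining
half-edges. -/
def onSetIso (hU : ∀ x, x ∈ U ↔ x ≠ v ∧ x ≠ w) (hv : ¬ G.HasSelfLoopAt v)
    (hvw : w ≠ v) (τ : G.Transition v) (hw : ¬ (G.resolve v hv τ).HasSelfLoopAt ⟨w, hvw⟩)
    (σ : (G.resolve v hv τ).Transition ⟨w, hvw⟩) :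
    Iso ((G.resolve v hv τ).resolve ⟨w, hvw⟩ hw σ) (G.onSet U (PerfectMatching.congr
      (awayEquiv hU hv hvw τ) ((G.resolve v hv τ).resolve ⟨w, hvw⟩ hw σ).edges)) where
  onV :=
    { toFun := fun x => ⟨x.1.1, (hU _).2 ⟨x.1.2, fun e => x.2 (Subtype.ext e)⟩⟩
      invFun := fun x => ⟨⟨x.1, ((hU _).1 x.2).1⟩, fun e => ((hU _).1 x.2).2
        (congrArg Subtype.val e)⟩
      left_inv := fun _ => rfl
      right_inv := fun _ => rfl }
  onH := awayEquiv hU hv hvw τ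
  vert_onH _ := rfl
  opp_onH h := PerfectMatching.congr_mate _ _ h

-- For fixed `τ`, each compatible `π` comes from exactly one transition at `w`, so exchanging the
-- two sums leaves a count of transitions `τ`. Invariance and recursion are hypotheses because the
-- induction supplies them only for smaller graphs.
open Classical in
theorem sum_resolve_resolve [Finite V] [Finite H] {k : ℕ} (hU : ∀ x, x ∈ U ↔ x ≠ v ∧ x ≠ w)
    (hv : ¬ G.HasSelfLoopAt v) (hw : ¬ G.HasSelfLoopAt w) (hvw : w ≠ v)
    (hinv : ∀ (τ : G.Transition v) (hw' : ¬ (G.resolve v hv τ).HasSelfLoopAt ⟨w, hvw⟩)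
      (σ : (G.resolve v hv τ).Transition ⟨w, hvw⟩) (π : PerfectMatching {h : H // G.vert h ∈ U}),
      Nonempty (Iso ((G.resolve v hv τ).resolve ⟨w, hvw⟩ hw' σ) (G.onSet U π)) →
      ((G.resolve v hv τ).resolve ⟨w, hvw⟩ hw' σ).martin k = (G.onSet U π).martin k)
    (hrec : ∀ τ, (G.resolve v hv τ).martin k =
      if hw' : (G.resolve v hv τ).HasSelfLoopAt ⟨w, hvw⟩ then 0 else
        ∑ σ, ((G.resolve v hv τ).resolve ⟨w, hvw⟩ hw' σ).martin k) :
    ∑ τ, (G.resolve v hv τ).martin k = ∑ π : PerfectMatching {h : H // G.vert h ∈ U},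
      Nat.card {τ : G.Transition v // G.Avoids τ w ∧ G.Keeps U π ∧ G.Extends U π τ} *
        (G.onSet U π).martin k := by
  have step : ∀ τ, (G.resolve v hv τ).martin k =
      ∑ π : PerfectMatching {h : H // G.vert h ∈ U},
        if G.Avoids τ w ∧ G.Keeps U π ∧ G.Extends U π τ then (G.onSet U π).martin k else 0 := by
    intro τ
    rw [hrec]
    split_ifs with hw'
    · refine (Finset.sum_eq_zero fun π _ => if_neg fun h => ?_).symm
      exact (hasSelfLoopAt_resolve_iff hv hw hvw τ).1 hw' h.1
    · have hav : G.Avoids τ w := by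
        by_contra h
        exact hw' ((hasSelfLoopAt_resolve_iff hv hw hvw τ).2 h)
      simp only [hav, true_and]
      rw [← Finset.sum_filter, Finset.sum_subtype (p := fun π => G.Keeps U π ∧ G.Extends U π τ) _
        (by simp)]
      let E := ((G.resolve v hv τ).transitionEquiv ⟨w, hvw⟩ hw').trans
        ((PerfectMatching.congr (awayEquiv hU hv hvw τ)).subtypeEquiv
          (q := fun π => G.Keeps U π ∧ G.Extends U π τ)
          (keeps_resolve_iff hU hv hvw τ))
      refine Fintype.sum_equiv E _ _ fun σ => ?_
      exact hinv τ hw' σ _ ⟨onSetIso hU hv hvw τ hw' σ⟩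
  simp only [step]
  rw [Finset.sum_comm]
  refine Finset.sum_congr rfl fun π _ => ?_
  rw [← Finset.sum_filter, Finset.sum_const, nsmul_eq_mul, Nat.card_eq_fintype_card,
    Fintype.card_subtype]

/-- A half-edge opposite to `v` and not at `w`. -/
abbrev OuterHalf (G : Multigraph V H) (v w : V) : Type v :=
  {a : {h : H // G.vert (G.opp h) = v} // ¬ G.vert a.1 = w}

theorem outerHalf_mem (hU : ∀ x, x ∈ U ↔ x ≠ v ∧ x ≠ w) (hv : ¬ G.HasSelfLoopAt v)
    (a : G.OuterHalf v w) : G.vert a.1.1 ∈ U :=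
  (hU _).2 ⟨fun e => hv ⟨_, e, a.1.2⟩, a.2⟩

open Classical in
/-- The involution exchanging the ends of those pairs of `π` with both ends adjacent to `v`. -/
noncomputable def pairInvolution (hU : ∀ x, x ∈ U ↔ x ≠ v ∧ x ≠ w) (hv : ¬ G.HasSelfLoopAt v)
    (π : PerfectMatching {h : H // G.vert h ∈ U}) (a : G.OuterHalf v w) : G.OuterHalf v w :=
  if h : G.vert (G.opp (π.mate ⟨a.1.1, outerHalf_mem hU hv a⟩).1) = v then
    ⟨⟨_, h⟩, ((hU _).1 (π.mate ⟨a.1.1, outerHalf_mem hU hv a⟩).2).2⟩ else a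

/-- The condition `a ≠ b` is essential: `a` is also the default value of the involution, whereas `π`
never pairs `a` with itself. -/
theorem pairInvolution_eq_iff (hU : ∀ x, x ∈ U ↔ x ≠ v ∧ x ≠ w) (hv : ¬ G.HasSelfLoopAt v)
    (π : PerfectMatching {h : H // G.vert h ∈ U}) (a b : G.OuterHalf v w) (hab : a ≠ b) :
    pairInvolution hU hv π a = b ↔ (π.mate ⟨a.1.1, outerHalf_mem hU hv a⟩).1 = b.1.1 := by
  unfold pairInvolution
  split_ifs with h
  · exact ⟨fun e => e ▸ rfl, fun e => Subtype.ext (Subtype.ext e)⟩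
  · exact ⟨fun e => absurd e hab, fun e => absurd (e ▸ b.1.2) h⟩

theorem pairInvolution_eq_self_iff (hU : ∀ x, x ∈ U ↔ x ≠ v ∧ x ≠ w) (hv : ¬ G.HasSelfLoopAt v)
    (π : PerfectMatching {h : H // G.vert h ∈ U}) (a : G.OuterHalf v w) :
    pairInvolution hU hv π a = a ↔
      G.vert (G.opp (π.mate ⟨a.1.1, outerHalf_mem hU hv a⟩).1) ≠ v := by
  unfold pairInvolution
  split_ifs with h
  · refine ⟨fun e => ?_, fun e => absurd h e⟩
    exact absurd (Subtype.ext (congrArg (fun z => z.1.1) e)) (π.mate_ne _)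
  · exact ⟨fun _ => h, fun _ => rfl⟩

theorem pairInvolution_involutive (hU : ∀ x, x ∈ U ↔ x ≠ v ∧ x ≠ w) (hv : ¬ G.HasSelfLoopAt v)
    (π : PerfectMatching {h : H // G.vert h ∈ U}) :
    Function.Involutive (pairInvolution hU hv π) := by
  intro a
  by_cases h : pairInvolution hU hv π a = a
  · rw [h, h]
  · have h1 := (pairInvolution_eq_iff hU hv π a _ (Ne.symm h)).1 rfl
    rw [pairInvolution_eq_iff hU hv π _ _ h]
    have h2 : π.mate ⟨a.1.1, outerHalf_mem hU hv a⟩ =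
      ⟨(pairInvolution hU hv π a).1.1, outerHalf_mem hU hv _⟩ := Subtype.ext h1
    rw [← h2, π.mate_mate]

/-- Pairs of `π` with exactly one end adjacent to `v`: their other end is adjacent to `w`. -/
theorem vert_opp_mate (hU : ∀ x, x ∈ U ↔ x ≠ v ∧ x ≠ w)
    {π : PerfectMatching {h : H // G.vert h ∈ U}}
    (hπ : G.Keeps U π) (hv : ¬ G.HasSelfLoopAt v) (a : G.OuterHalf v w)
    (ha : pairInvolution hU hv π a = a) :
    G.vert (G.opp (π.mate ⟨a.1.1, outerHalf_mem hU hv a⟩).1) = w := by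
  have h1 := (pairInvolution_eq_self_iff hU hv π a).1 ha
  by_contra h2
  have h3 := hπ _ ((hU _).2 ⟨h1, h2⟩)
  rw [π.mate_mate] at h3
  have h4 := a.1.2
  have h5 : G.opp a.1.1 = (π.mate ⟨a.1.1, outerHalf_mem hU hv a⟩).1 := by
    rw [← G.opp_opp (π.mate ⟨a.1.1, outerHalf_mem hU hv a⟩).1, ← h3]
  rw [h5] at h4
  exact ((hU _).1 (π.mate ⟨a.1.1, outerHalf_mem hU hv a⟩).2).1 h4

/-- A fixed point around `v` is an end of a pair of `π` linking `v` to `w`; the other end is a fixed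
point around `w`. Applied in both directions this gives equality. -/
theorem card_fixed_pairInvolution_le [Finite H] (hU : ∀ x, x ∈ U ↔ x ≠ v ∧ x ≠ w)
    (hU' : ∀ x, x ∈ U ↔ x ≠ w ∧ x ≠ v) {π : PerfectMatching {h : H // G.vert h ∈ U}}
    (hπ : G.Keeps U π) (hv : ¬ G.HasSelfLoopAt v) (hw : ¬ G.HasSelfLoopAt w) (hvw : w ≠ v) :
    Nat.card {a : G.OuterHalf v w // pairInvolution hU hv π a = a} ≤
      Nat.card {a : G.OuterHalf w v // pairInvolution hU' hw π a = a} := by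
  refine Nat.card_le_card_of_injective (fun a => ⟨⟨⟨_, vert_opp_mate hU hπ hv a.1 a.2⟩,
    ((hU _).1 (π.mate ⟨a.1.1.1, outerHalf_mem hU hv a.1⟩).2).1⟩, ?_⟩) ?_
  · rw [pairInvolution_eq_self_iff]
    simp only [Subtype.coe_eta, π.mate_mate]
    rw [a.1.1.2]
    exact hvw.symm
  · intro a b hab
    have h1 : (π.mate ⟨a.1.1.1, outerHalf_mem hU hv a.1⟩).1 =
      (π.mate ⟨b.1.1.1, outerHalf_mem hU hv b.1⟩).1 := congrArg (fun z => z.1.1.1) hab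
    have h2 := congrArg π.mate (Subtype.ext h1)
    rw [π.mate_mate, π.mate_mate] at h2
    have h3 : a.1.1.1 = b.1.1.1 := (congrArg Subtype.val h2 :)
    exact Subtype.ext (Subtype.ext (Subtype.ext h3))

/-- The neighbourhoods of `v` and `w` correspond to each other compatibly with `π`. -/
theorem exists_swap_equiv [Finite H] {d : ℕ} (hG : G.IsRegular d)
    (hU : ∀ x, x ∈ U ↔ x ≠ v ∧ x ≠ w) (hU' : ∀ x, x ∈ U ↔ x ≠ w ∧ x ≠ v)
    {π : PerfectMatching {h : H // G.vert h ∈ U}} (hπ : G.Keeps U π)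
    (hv : ¬ G.HasSelfLoopAt v) (hw : ¬ G.HasSelfLoopAt w) (hvw : w ≠ v) :
    ∃ Θ : {h : H // G.vert (G.opp h) = v} ≃ {h : H // G.vert (G.opp h) = w},
      (∀ a, G.vert (Θ a).1 = v ↔ G.vert a.1 = w) ∧
      ∀ a b, a ≠ b → ∀ (ha : G.vert a.1 ∈ U) (_ : G.vert b.1 ∈ U) (ha' : G.vert (Θ a).1 ∈ U),
        (π.mate ⟨(Θ a).1, ha'⟩).1 = (Θ b).1 ↔ (π.mate ⟨a.1, ha⟩).1 = b.1 := by
  classical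
  -- On edges between `v` and `w` the correspondence exchanges the two halves; the remaining
  -- half-edges are equally many on both sides by regularity.
  let eE : {a : {h : H // G.vert (G.opp h) = v} // G.vert a.1 = w} ≃
      {a : {h : H // G.vert (G.opp h) = w} // G.vert a.1 = v} :=
    { toFun := fun a => ⟨⟨G.opp a.1.1, by rw [G.opp_opp]; exact a.2⟩, a.1.2⟩
      invFun := fun a => ⟨⟨G.opp a.1.1, by rw [G.opp_opp]; exact a.2⟩, a.1.2⟩
      left_inv := fun a => Subtype.ext (Subtype.ext (G.opp_opp _))
      right_inv := fun a => Subtype.ext (Subtype.ext (G.opp_opp _)) }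
  have hcard : Nat.card (G.OuterHalf v w) = Nat.card (G.OuterHalf w v) := by
    have h1 := Nat.card_congr (Equiv.sumCompl
      fun a : {h : H // G.vert (G.opp h) = v} => G.vert a.1 = w)
    have h2 := Nat.card_congr (Equiv.sumCompl
      fun a : {h : H // G.vert (G.opp h) = w} => G.vert a.1 = v)
    rw [Nat.card_sum, card_opp_eq, hG] at h1 h2
    have h3 := Nat.card_congr eE
    unfold OuterHalf
    omega
  have hfix := (card_fixed_pairInvolution_le hU hU' hπ hv hw hvw).antisymm
    (card_fixed_pairInvolution_le hU' hU hπ hw hv hvw.symm)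
  obtain ⟨e, he⟩ := PerfectMatching.exists_equiv_semiconj
    (pairInvolution_involutive hU hv π) (pairInvolution_involutive hU' hw π) hcard hfix
  let Θ := (Equiv.sumCompl fun a : {h : H // G.vert (G.opp h) = v} => G.vert a.1 = w).symm.trans
    ((eE.sumCongr e).trans
      (Equiv.sumCompl fun a : {h : H // G.vert (G.opp h) = w} => G.vert a.1 = v))
  have hΘ₁ : ∀ a (ha : G.vert a.1 = w), Θ a = (eE ⟨a, ha⟩).1 := fun a ha => by
    simp only [Θ, Equiv.trans_apply, Equiv.sumCompl_symm_apply_of_pos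
      (p := fun a : {h : H // G.vert (G.opp h) = v} => G.vert a.1 = w) ha]
    rfl
  have hΘ₂ : ∀ a (ha : ¬ G.vert a.1 = w), Θ a = (e ⟨a, ha⟩).1 := fun a ha => by
    simp only [Θ, Equiv.trans_apply, Equiv.sumCompl_symm_apply_of_neg
      (p := fun a : {h : H // G.vert (G.opp h) = v} => G.vert a.1 = w) ha]
    rfl
  refine ⟨Θ, fun a => ?_, fun a b hab ha hb ha' => ?_⟩
  · by_cases ha : G.vert a.1 = w
    · rw [hΘ₁ a ha]
      exact iff_of_true (eE ⟨a, ha⟩).2 ha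
    · rw [hΘ₂ a ha]
      exact iff_of_false (e ⟨a, ha⟩).2 ha
  · have haw := ((hU _).1 ha).2
    have hbw := ((hU _).1 hb).2
    have hne : (⟨a, haw⟩ : G.OuterHalf v w) ≠ ⟨b, hbw⟩ := fun h => hab (congrArg Subtype.val h)
    have h1 := pairInvolution_eq_iff hU hv π ⟨a, haw⟩ ⟨b, hbw⟩ hne
    have h2 := pairInvolution_eq_iff hU' hw π (e ⟨a, haw⟩) (e ⟨b, hbw⟩) (e.injective.ne hne)
    rw [← he, e.injective.eq_iff, h1] at h2
    have h3 : (⟨(Θ a).1, ha'⟩ : {h : H // G.vert h ∈ U}) =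
        ⟨(e ⟨a, haw⟩).1.1, outerHalf_mem hU' hw _⟩ :=
      Subtype.ext (congrArg Subtype.val (hΘ₂ a haw) :)
    rw [h3, hΘ₂ b hbw]
    exact h2.symm

/-- The conditions on `τ` only see which half-edges lie at the other vertex and which outer ones `π`
pairs; `exists_swap_equiv` transports both. If `π` does not keep the old edges, both counts are
zero. -/
theorem card_transition_swap [Finite H] {d : ℕ} (hG : G.IsRegular d)
    (hU : ∀ x, x ∈ U ↔ x ≠ v ∧ x ≠ w) (π : PerfectMatching {h : H // G.vert h ∈ U})
    (hv : ¬ G.HasSelfLoopAt v) (hw : ¬ G.HasSelfLoopAt w) (hvw : w ≠ v) :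
    Nat.card {τ : G.Transition v // G.Avoids τ w ∧ G.Keeps U π ∧ G.Extends U π τ} =
    Nat.card {τ : G.Transition w // G.Avoids τ v ∧ G.Keeps U π ∧ G.Extends U π τ} := by
  have hU' : ∀ x, x ∈ U ↔ x ≠ w ∧ x ≠ v := fun x => (hU x).trans and_comm
  by_cases hπ : G.Keeps U π
  swap
  · have : ∀ x (τ : G.Transition x) y, ¬ (G.Avoids τ y ∧ G.Keeps U π ∧ G.Extends U π τ) :=
      fun x τ y h => hπ h.2.1
    simp [this]
  obtain ⟨Θ, h1, h2⟩ := exists_swap_equiv hG hU hU' hπ hv hw hvw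
  have hmem : ∀ a : {h : H // G.vert (G.opp h) = v}, G.vert (Θ a).1 ∈ U ↔ G.vert a.1 ∈ U := by
    intro a
    rw [hU', hU, ne_eq (G.vert (Θ a).1) v, h1 a]
    exact ⟨fun h => ⟨fun e => hv ⟨_, e, a.2⟩, h.2⟩, fun h => ⟨fun e => hw ⟨_, e, (Θ a).2⟩, h.2⟩⟩
  refine Nat.card_congr ((PerfectMatching.congr Θ).subtypeEquiv fun τ => ?_)
  refine and_congr ?_ (and_congr_right fun _ => ?_)
  · unfold Avoids
    rw [← Θ.forall_congr_right]
    simp only [PerfectMatching.congr_mate, h1]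
    exact forall_congr' fun a => imp_congr Iff.rfl (not_iff_not.2 (h1 _)).symm
  · unfold Extends
    rw [← Θ.forall_congr_right (q := fun b => G.vert _ ∈ U → ∀ ha : G.vert b.1 ∈ U, _)]
    refine forall_congr' fun a => ?_
    rw [PerfectMatching.congr_mate]
    constructor
    · intro h h3 h4
      exact (h2 a (τ.mate a) (τ.mate_ne a).symm ((hmem a).1 h4) ((hmem _).1 h3) h4).2
        (h ((hmem _).1 h3) ((hmem _).1 h4))
    · intro h h3 h4
      exact (h2 a (τ.mate a) (τ.mate_ne a).symm h4 h3 ((hmem _).2 h4)).1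
        (h ((hmem _).2 h3) ((hmem _).2 h4))

end

end Multigraph

/-! ### Counting matchings between two classes. -/

namespace PerfectMatching

open Classical in
/-- Matchings between the elements with and without a property are bijections. -/
noncomputable def crossingEquiv {α : Type*} (p : α → Prop) :
    {m : PerfectMatching α // ∀ a, p (m.mate a) ↔ ¬ p a} ≃ ({a // p a} ≃ {a // ¬ p a}) where
  toFun m :=
    { toFun := fun a => ⟨m.1.mate a.1, fun h => (m.2 _).1 h a.2⟩
      invFun := fun a => ⟨m.1.mate a.1, (m.2 _).2 a.2⟩
      left_inv := fun a => Subtype.ext (m.1.mate_mate _)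
      right_inv := fun a => Subtype.ext (m.1.mate_mate _) }
  invFun e :=
    ⟨⟨fun a => if h : p a then (e ⟨a, h⟩).1 else (e.symm ⟨a, h⟩).1, fun a => by
        by_cases h : p a
        · have := (e ⟨a, h⟩).2
          simp [h, this]
        · have := (e.symm ⟨a, h⟩).2
          simp [h, this], fun a ha => by
        by_cases h : p a
        · simp only [h, dite_true] at ha
          exact (e ⟨a, h⟩).2 (by rwa [ha])
        · simp only [h, dite_false] at ha
          exact h (by rw [← ha]; exact (e.symm ⟨a, h⟩).2)⟩, fun a => by
      by_cases h : p a
      · have := (e ⟨a, h⟩).2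
        simp [h, this, mate]
      · have := (e.symm ⟨a, h⟩).2
        simp [h, this, mate]⟩
  left_inv m := by
    refine Subtype.ext (ext_mate fun a => ?_)
    by_cases h : p a <;> simp [mate, h]
  right_inv e := by
    ext a
    have := a.2
    simp [mate, this]

theorem card_crossing {α : Type*} [Finite α] (p : α → Prop) {k : ℕ}
    (h₁ : Nat.card {a // p a} = k) (h₂ : Nat.card {a // ¬ p a} = k) :
    Nat.card {m : PerfectMatching α // ∀ a, p (m.mate a) ↔ ¬ p a} = k.factorial := by
  classical
  have := Fintype.ofFinite α
  rw [Nat.card_congr (crossingEquiv p), Nat.card_eq_fintype_card]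
  rw [Nat.card_eq_fintype_card] at h₁ h₂
  rw [Fintype.card_equiv (Fintype.equivOfCardEq (h₁.trans h₂.symm)), h₁]

end PerfectMatching

namespace Multigraph

universe u v

variable {V V' : Type u} {H H' : Type v}

/-! ### The recursion at an arbitrary vertex -/

/-- The number of half-edges at `x` whose other half is at `y`. -/
noncomputable def mult (G : Multigraph V H) (x y : V) : ℕ :=
  Nat.card {a : {h : H // G.vert (G.opp h) = y} // G.vert a.1 = x}

theorem mult_comm (G : Multigraph V H) (x y : V) : G.mult x y = G.mult y x :=
  Nat.card_congr
    { toFun := fun a => ⟨⟨G.opp a.1.1, by rw [G.opp_opp]; exact a.2⟩, a.1.2⟩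
      invFun := fun a => ⟨⟨G.opp a.1.1, by rw [G.opp_opp]; exact a.2⟩, a.1.2⟩
      left_inv := fun a => Subtype.ext (Subtype.ext (G.opp_opp _))
      right_inv := fun a => Subtype.ext (Subtype.ext (G.opp_opp _)) }

theorem mult_add_mult [Finite H] {G : Multigraph V H} (hG : ¬ G.HasSelfLoop) {x y z : V}
    (hyz : y ≠ z) (h : ∀ t, t = x ∨ t = y ∨ t = z) : G.mult y x + G.mult z x = G.degree x := by
  classical
  rw [← card_opp_eq, mult, mult, ← Nat.card_sum]
  refine Nat.card_congr (Equiv.trans (Equiv.sumCongr (Equiv.refl _) ?_)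
    (Equiv.sumCompl fun a : {h : H // G.vert (G.opp h) = x} => G.vert a.1 = y))
  refine Equiv.subtypeEquivRight fun a => ⟨fun e e' => hyz (e'.symm.trans e), fun e => ?_⟩
  rcases h (G.vert a.1) with h1 | h1 | h1
  · exact absurd ⟨x, a.1, h1, a.2⟩ hG
  · exact absurd h1 e
  · exact h1

-- Regularity forces exactly `k` edges between any two of the three vertices. A resolution is
-- loop-free if and only if `τ` matches the `k` half-edges at `a` with those at `b`; there are `k!`
-- such `τ`, each contributing `1 / k!`.
open Classical in
theorem martin_eq_sum_of_card_three [Finite V] [Finite H] {k : ℕ} {G : Multigraph V H}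
    (hG : G.IsRegular (2 * k)) (hV : Nat.card V = 3) (hl : ¬ G.HasSelfLoop) (v : V) :
    G.martin k = ∑ τ : G.Transition v, (G.resolve v (fun h => hl ⟨v, h⟩) τ).martin k := by
  have hl' : ∀ x, ¬ G.HasSelfLoopAt x := fun x h => hl ⟨x, h⟩
  have hc : Nat.card {w // w ≠ v} = 2 := by rw [card_ne, hV]
  obtain ⟨⟨a, hav⟩, ⟨b, hbv⟩, hab, huniv⟩ := Nat.card_eq_two_iff.1 hc
  replace hab : a ≠ b := fun e => hab (Subtype.ext e)
  have hall : ∀ t, t = v ∨ t = a ∨ t = b := by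
    intro t
    by_cases ht : t = v
    · exact Or.inl ht
    · have : (⟨t, ht⟩ : {w // w ≠ v}) ∈ ({⟨a, hav⟩, ⟨b, hbv⟩} : Set _) := by
        rw [huniv]; exact Set.mem_univ _
      rcases this with h | h
      · exact Or.inr (Or.inl (congrArg Subtype.val h))
      · exact Or.inr (Or.inr (congrArg Subtype.val h))
  have m1 := mult_add_mult hl hab hall
  have m2 := mult_add_mult hl (x := a) (y := v) (z := b) hbv.symm
    (fun t => by rcases hall t with h | h | h <;> simp [h])
  have m3 := mult_add_mult hl (x := b) (y := v) (z := a) hav.symm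
    (fun t => by rcases hall t with h | h | h <;> simp [h])
  rw [hG] at m1 m2 m3
  have s1 := G.mult_comm a v
  have s2 := G.mult_comm b v
  have s3 := G.mult_comm a b
  have hat : ∀ x : {h : H // G.vert (G.opp h) = v}, ¬ G.vert x.1 = a ↔ G.vert x.1 = b := by
    intro x
    rcases hall (G.vert x.1) with h | h | h
    · exact absurd ⟨x.1, h, x.2⟩ (hl' v)
    · simp [h, hab]
    · simp [h, hab.symm]
  have hloop : ∀ τ : G.Transition v, (G.resolve v (hl' v) τ).HasSelfLoop ↔
      ¬ ∀ x, G.vert (τ.mate x).1 = a ↔ ¬ G.vert x.1 = a := by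
    intro τ
    have e1 := hasSelfLoopAt_resolve_iff (hl' v) (hl' a) hav τ
    have e2 := hasSelfLoopAt_resolve_iff (hl' v) (hl' b) hbv τ
    have e3 : (G.resolve v (hl' v) τ).HasSelfLoop ↔
        ¬ G.Avoids τ a ∨ ¬ G.Avoids τ b := by
      rw [← e1, ← e2]
      constructor
      · rintro ⟨⟨t, htv⟩, ht⟩
        rcases hall t with h | h | h
        · exact absurd h htv
        · subst h; exact Or.inl ht
        · subst h; exact Or.inr ht
      · rintro (h | h)
        · exact ⟨_, h⟩
        · exact ⟨_, h⟩
    rw [e3, ← not_and_or, not_iff_not]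
    unfold Avoids
    constructor
    · rintro ⟨h1, h2⟩ x
      refine ⟨fun h3 h4 => h1 x h4 h3, fun h3 => ?_⟩
      by_contra h4
      exact h2 x ((hat x).1 h3) ((hat _).1 h4)
    · intro h
      refine ⟨fun x h1 h2 => (h x).1 h2 h1, fun x h1 h2 => ?_⟩
      exact (hat _).2 h2 ((h x).2 ((hat x).2 h1))
  rw [martin_of_card_three k hl hV]
  have hterm : ∀ τ : G.Transition v, (G.resolve v (hl' v) τ).martin k =
      if ∀ x, G.vert (τ.mate x).1 = a ↔ ¬ G.vert x.1 = a then (1 / k.factorial : ℚ) else 0 := by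
    intro τ
    split_ifs with h
    · exact martin_of_card_two k (fun h' => (hloop τ).1 h' h) hc
    · exact martin_eq_zero_of_hasSelfLoop k ((hloop τ).2 h) hc.ge
  rw [Finset.sum_congr rfl fun τ _ => hterm τ, ← Finset.sum_filter, Finset.sum_const, nsmul_eq_mul,
    ← Fintype.card_subtype, ← Nat.card_eq_fintype_card, PerfectMatching.card_crossing (k := k)
      (fun x : {h : H // G.vert (G.opp h) = v} => G.vert x.1 = a)]
  · have : (k.factorial : ℚ) ≠ 0 := by exact_mod_cast k.factorial_ne_zero
    field_simp
  · change G.mult a v = k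
    omega
  · rw [Nat.card_congr (Equiv.subtypeEquivRight hat)]
    change G.mult b v = k
    omega

/-- The recursion at every vertex, for regular multigraphs with `n` vertices. -/
def RecursionHolds (k n : ℕ) : Prop :=
  ∀ ⦃V : Type u⦄ ⦃H : Type v⦄ [Finite V] [Finite H] (G : Multigraph V H), G.IsRegular (2 * k) →
    Nat.card V = n → ∀ (hl : ¬ G.HasSelfLoop) (v : V),
    G.martin k = ∑ τ : G.Transition v, (G.resolve v (fun h => hl ⟨v, h⟩) τ).martin k

/-- The invariance under isomorphisms, for regular multigraphs with `n` vertices. -/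
def InvarianceHolds (k n : ℕ) : Prop :=
  ∀ ⦃V V' : Type u⦄ ⦃H H' : Type v⦄ [Finite V] [Finite H] [Finite V'] [Finite H']
    (G : Multigraph V H) (G' : Multigraph V' H'), G.IsRegular (2 * k) → Nat.card V = n →
    Iso G G' → G.martin k = G'.martin k

theorem Iso.isRegular {G : Multigraph V H} {G' : Multigraph V' H'} (f : Iso G G') {d : ℕ}
    (hG : G.IsRegular d) : G'.IsRegular d := by
  intro w
  obtain ⟨v, rfl⟩ := f.onV.surjective w
  rw [← hG v]
  exact (Nat.card_congr (f.onH.subtypeEquiv fun h => by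
    rw [f.vert_onH, f.onV.injective.eq_iff])).symm

theorem invarianceHolds_of_le_three {k n : ℕ} (h₁ : 1 ≤ n) (h₃ : n ≤ 3) :
    InvarianceHolds.{u, v} k n := by
  intro V V' H H' _ _ _ _ G G' _ hn f
  have hn' : Nat.card V' = n := by rw [← hn, Nat.card_congr f.onV]
  rcases (by omega : n = 1 ∨ n = 2 ∨ n = 3) with rfl | rfl | rfl
  · rw [martin_of_card_one k G hn, martin_of_card_one k G' hn']
  · by_cases hl : G.HasSelfLoop
    · rw [martin_eq_zero_of_hasSelfLoop k hl (by omega),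
        martin_eq_zero_of_hasSelfLoop k (f.hasSelfLoop_iff.2 hl) (by omega)]
    · rw [martin_of_card_two k hl hn, martin_of_card_two k (mt f.hasSelfLoop_iff.1 hl) hn']
  · by_cases hl : G.HasSelfLoop
    · rw [martin_eq_zero_of_hasSelfLoop k hl (by omega),
        martin_eq_zero_of_hasSelfLoop k (f.hasSelfLoop_iff.2 hl) (by omega)]
    · rw [martin_of_card_three k hl hn, martin_of_card_three k (mt f.hasSelfLoop_iff.1 hl) hn']

/-- The vertices picked in the definition need not correspond under the isomorphism, so the
recursion at an arbitrary vertex is needed to expand both graphs compatibly. -/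
theorem RecursionHolds.invarianceHolds {k n : ℕ} (hn : 3 ≤ n)
    (hr : RecursionHolds.{u, v} k (n + 1)) (hi : InvarianceHolds.{u, v} k n) :
    InvarianceHolds.{u, v} k (n + 1) := by
  intro V V' H H' _ _ _ _ G G' hG hV f
  have hV' : Nat.card V' = n + 1 := by rw [← hV, Nat.card_congr f.onV]
  by_cases hl : G.HasSelfLoop
  · rw [martin_eq_zero_of_hasSelfLoop k hl (by omega),
      martin_eq_zero_of_hasSelfLoop k (f.hasSelfLoop_iff.2 hl) (by omega)]
  have hl' := mt f.hasSelfLoop_iff.1 hl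
  obtain ⟨v⟩ : Nonempty V := (Nat.card_pos_iff.1 (by omega)).1
  rw [hr G hG hV hl v, hr G' (f.isRegular hG) hV' hl' (f.onV v)]
  refine Fintype.sum_equiv (PerfectMatching.congr (f.oppEquiv v)) _ _ fun τ => ?_
  exact hi _ _ (resolve_isRegular hG _ _ _) (by rw [card_ne, hV]; rfl) (f.resolve v _ _ τ)

open Classical in
/-- The recursion, extended to multigraphs with self-loops. -/
theorem RecursionHolds.martin_eq_dite {k n : ℕ} (hr : RecursionHolds.{u, v} k n) (hn : 3 ≤ n)
    [Finite V] [Finite H] (G : Multigraph V H) (hG : G.IsRegular (2 * k)) (hV : Nat.card V = n)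
    (v : V) : G.martin k = if hv : G.HasSelfLoopAt v then 0 else
      ∑ τ, (G.resolve v hv τ).martin k := by
  split_ifs with hv
  · exact martin_eq_zero_of_hasSelfLoop k ⟨v, hv⟩ (by omega)
  · by_cases hl : G.HasSelfLoop
    · rw [martin_eq_zero_of_hasSelfLoop k hl (by omega)]
      obtain ⟨w, hw⟩ := hl
      have hwv : w ≠ v := fun e => hv (e ▸ hw)
      refine (Finset.sum_eq_zero fun τ _ => ?_).symm
      exact martin_eq_zero_of_hasSelfLoop k ⟨_, hasSelfLoopAt_resolve hv τ hwv hw⟩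
        (by rw [card_ne]; omega)
    · exact hr G hG hV hl v

/-- The vertex `v` picked by the definition is compared with any other `w` by expanding twice in
both orders. The doubly resolved graphs have `n - 1` vertices, which is where invariance is used. -/
theorem RecursionHolds.succ {k n : ℕ} (hn : 3 ≤ n) (hr : RecursionHolds.{u, v} k n)
    (hi : InvarianceHolds.{u, v} k (n - 1)) : RecursionHolds.{u, v} k (n + 1) := by
  intro V H _ _ G hG hV hl w
  obtain ⟨v, hv⟩ := exists_martin_eq_sum k hl (by omega)
  rw [hv]
  by_cases hvw : w = v
  · rw [hvw]
  have hl' : ∀ x, ¬ G.HasSelfLoopAt x := fun x h => hl ⟨x, h⟩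
  let U : Set V := {x | x ≠ v ∧ x ≠ w}
  have hU : ∀ x, x ∈ U ↔ x ≠ v ∧ x ≠ w := fun x => Iff.rfl
  have hU' : ∀ x, x ∈ U ↔ x ≠ w ∧ x ≠ v := fun x => and_comm
  have key := fun (x y : V) (hxy : y ≠ x) (hU : ∀ t, t ∈ U ↔ t ≠ x ∧ t ≠ y) =>
    sum_resolve_resolve (k := k) hU (hl' x) (hl' y) hxy
      (fun τ hw' σ π ⟨f⟩ => hi _ _ (resolve_isRegular (resolve_isRegular hG _ _ _) _ _ _)
        (by rw [card_ne, card_ne]; omega) f)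
      (fun τ => hr.martin_eq_dite hn _ (resolve_isRegular hG _ _ _) (by rw [card_ne]; omega) _)
  rw [key v w hvw hU, key w v (Ne.symm hvw) hU']
  refine Finset.sum_congr rfl fun π _ => ?_
  rw [card_transition_swap hG hU π (hl' v) (hl' w) hvw]

theorem recursionHolds_and_invarianceHolds (k n : ℕ) : RecursionHolds.{u, v} k (n + 3) ∧
    InvarianceHolds.{u, v} k (n + 3) ∧ InvarianceHolds.{u, v} k (n + 2) := by
  induction n with
  | zero =>
    refine ⟨?_,
      invarianceHolds_of_le_three (by omega) (by omega),
      invarianceHolds_of_le_three (by omega) (by omega)⟩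
    intro V H _ _ G hG hV hl v
    exact martin_eq_sum_of_card_three hG hV hl v
  | succ n ih =>
    obtain ⟨h1, h2, h3⟩ := ih
    have h4 := h1.succ (by omega) h3
    exact ⟨h4, h4.invarianceHolds (by omega) h2, h2⟩

/-- The recursion for the Martin invariant holds at every vertex. -/
theorem martin_eq_sum [Finite V] [Finite H] {k : ℕ} {G : Multigraph V H}
    (hG : G.IsRegular (2 * k)) (hV : 3 ≤ Nat.card V) (hl : ¬ G.HasSelfLoop) (v : V) :
    G.martin k = ∑ τ : G.Transition v, (G.resolve v (fun h => hl ⟨v, h⟩) τ).martin k := by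
  obtain ⟨n, hn⟩ := Nat.exists_eq_add_of_le' hV
  exact (recursionHolds_and_invarianceHolds k n).1 G hG hn hl v

/-- Isomorphic regular multigraphs have the same Martin invariant. -/
theorem Iso.martin_eq [Finite V] [Finite H] [Finite V'] [Finite H'] {k : ℕ} {G : Multigraph V H}
    {G' : Multigraph V' H'} (hG : G.IsRegular (2 * k)) (hV : 2 ≤ Nat.card V) (f : Iso G G') :
    G.martin k = G'.martin k := by
  obtain ⟨n, hn⟩ := Nat.exists_eq_add_of_le' hV
  exact (recursionHolds_and_invarianceHolds k n).2.2 G G' hG hn f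

end Multigraph

/-! ### Splitting off

The half-edges `K` at the vertices `W` carry an involution `m`; its fixed points are the half-edges
which are joined to one further vertex. -/

section Splitting

variable {W K : Type*} [Fintype K]

open Classical in
/-- Whether the half-edge `h` at `X` belongs to the cut between `X` and the other vertices. -/
noncomputable def cutIndicator (p : K → W) (m : K → K) (X : Set W) (h : K) : ℕ :=
  if p h ∈ X ∧ (m h = h ∨ p (m h) ∉ X) then 1 else 0

/-- The size of the cut between `X` and the other vertices, including the further one. -/
noncomputable def legCut (p : K → W) (m : K → K) (X : Set W) : ℕ := ∑ h, cutIndicator p m X h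

theorem legCut_eq_card (p : K → W) (m : K → K) (X : Set W) :
    legCut p m X = Nat.card {h // p h ∈ X ∧ (m h = h ∨ p (m h) ∉ X)} := by
  classical
  rw [Nat.card_eq_fintype_card, Fintype.card_subtype, Finset.card_filter]
  rfl

theorem card_fiber_mem [Finite W] {p : K → W} {d : ℕ} (hd : ∀ w, Nat.card {h // p h = w} = d)
    (X : Set W) : Nat.card {h // p h ∈ X} = Nat.card X * d := by
  classical
  have := Fintype.ofFinite W
  let e : {h // p h ∈ X} ≃ Σ x : X, {h // p h = x} :=
    { toFun := fun h => ⟨⟨_, h.2⟩, h.1, rfl⟩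
      invFun := fun h => ⟨h.2.1, by rw [h.2.2]; exact h.1.2⟩
      left_inv := fun _ => rfl
      right_inv := by
        rintro ⟨⟨x, hx⟩, h, e⟩
        obtain rfl : p h = x := e
        rfl }
  rw [Nat.card_congr e, Nat.card_sigma]
  simp only [hd, Finset.sum_const, smul_eq_mul, Finset.card_univ, Nat.card_eq_fintype_card]

/-- Symmetrizing over the two halves of each edge allows cut identities that fail for single
half-edges to be checked edge by edge. -/
theorem two_mul_legCut (p : K → W) {m : K → K} (hm : Function.Involutive m) (X : Set W) :
    2 * legCut p m X = ∑ h, (cutIndicator p m X h + cutIndicator p m X (m h)) := by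
  rw [Finset.sum_add_distrib, two_mul, legCut]
  congr 1
  exact (Equiv.sum_comp hm.toPerm _).symm

/-- Submodularity of cuts; it holds for every half-edge separately. -/
theorem legCut_union_add_inter (p : K → W) (m : K → K) (X Y : Set W) :
    legCut p m (X ∪ Y) + legCut p m (X ∩ Y) ≤ legCut p m X + legCut p m Y := by
  unfold legCut
  rw [← Finset.sum_add_distrib, ← Finset.sum_add_distrib]
  refine Finset.sum_le_sum fun h _ => ?_
  unfold cutIndicator
  by_cases h1 : p h ∈ X <;> by_cases h2 : p h ∈ Y <;> by_cases h3 : p (m h) ∈ X <;>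
    by_cases h4 : p (m h) ∈ Y <;> by_cases h5 : m h = h <;> simp [h1, h2, h3, h4, h5]

-- The version of submodularity for differences. A half-edge at `X ∩ Y` joined to the further vertex
-- counts in both cuts on the right and in none on the left, whence the surplus of two.
open Classical in
theorem legCut_sdiff_add_sdiff (p : K → W) {m : K → K} (hm : Function.Involutive m) (X Y : Set W) :
    legCut p m (X \ Y) + legCut p m (Y \ X) + ∑ h, (if m h = h ∧ p h ∈ X ∩ Y then 2 else 0) ≤
      legCut p m X + legCut p m Y := by
  refine Nat.le_of_mul_le_mul_left (c := 2) ?_ (by norm_num)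
  rw [mul_add, mul_add, mul_add, two_mul_legCut p hm, two_mul_legCut p hm, two_mul_legCut p hm,
    two_mul_legCut p hm, ← Finset.sum_add_distrib, Finset.mul_sum, ← Finset.sum_add_distrib,
    ← Finset.sum_add_distrib]
  refine Finset.sum_le_sum fun h _ => ?_
  unfold cutIndicator
  rw [hm h]
  by_cases h5 : m h = h
  · by_cases h1 : p h ∈ X <;> by_cases h2 : p h ∈ Y <;> simp [h1, h2, h5]
  · have h6 : ¬ h = m h := fun e => h5 e.symm
    by_cases h1 : p h ∈ X <;> by_cases h2 : p h ∈ Y <;> by_cases h3 : p (m h) ∈ X <;>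
      by_cases h4 : p (m h) ∈ Y <;> simp [h1, h2, h3, h4, h5, h6]

open Classical in
theorem legCut_compl_add (p : K → W) {m : K → K} (hm : Function.Involutive m) (X : Set W)
    (hX : ∀ h, m h = h → p h ∈ X) :
    legCut p m Xᶜ + ∑ h, (if m h = h then 1 else 0) = legCut p m X := by
  refine Nat.eq_of_mul_eq_mul_left (by norm_num : 0 < 2) ?_
  rw [mul_add, two_mul_legCut p hm, two_mul_legCut p hm, Finset.mul_sum, ← Finset.sum_add_distrib]
  refine Finset.sum_congr rfl fun h _ => ?_
  unfold cutIndicator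
  rw [hm h]
  by_cases h5 : m h = h
  · simp [h5, hX h h5]
  · have h6 : ¬ h = m h := fun e => h5 e.symm
    by_cases h1 : p h ∈ X <;> by_cases h3 : p (m h) ∈ X <;> simp [h1, h3, h5, h6]

-- The half-edges at `X` outside the cut are paired off by `m`, so the cut has the parity of the
-- total number of half-edges at `X`.
open Classical in
theorem even_legCut (p : K → W) {m : K → K} (hm : Function.Involutive m) (X : Set W)
    (hX : Even (Nat.card {h // p h ∈ X})) : Even (legCut p m X) := by
  have h1 : legCut p m X + (Finset.univ.filter
      fun h => p h ∈ X ∧ m h ≠ h ∧ p (m h) ∈ X).card = Nat.card {h // p h ∈ X} := by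
    rw [Nat.card_eq_fintype_card, Fintype.card_subtype, Finset.card_filter, Finset.card_filter,
      legCut, ← Finset.sum_add_distrib]
    refine Finset.sum_congr rfl fun h _ => ?_
    unfold cutIndicator
    by_cases h1 : p h ∈ X <;> by_cases h2 : m h = h <;> by_cases h3 : p (m h) ∈ X <;>
      simp [h1, h2, h3]
  have h2 : Even (Finset.univ.filter fun h => p h ∈ X ∧ m h ≠ h ∧ p (m h) ∈ X).card := by
    rw [← ZMod.natCast_eq_zero_iff_even, Finset.card_eq_sum_ones, Nat.cast_sum]
    refine Finset.sum_involution (fun h _ => m h) (fun h _ => by decide) (fun h hh _ => ?_)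
      (fun h hh => ?_) (fun h _ => hm h)
    · exact (Finset.mem_filter.1 hh).2.2.1
    · obtain ⟨-, a, b, c⟩ := Finset.mem_filter.1 hh
      refine Finset.mem_filter.2 ⟨Finset.mem_univ _, c, ?_, ?_⟩
      · rw [hm h]; exact b.symm
      · rwa [hm h]
  rw [← h1] at hX
  exact (Nat.even_add.1 hX).2 h2

/-- All cuts between vertices other than the further one have size at least `d`. -/
def CutsAtLeast (p : K → W) (m : K → K) (d : ℕ) : Prop :=
  ∀ X : Set W, X.Nonempty → Xᶜ.Nonempty → d ≤ legCut p m X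

/-- A half-edge joined to the further vertex can be paired with another one such that no minimum cut
has both on the same side. -/
theorem exists_partner [Finite W] [Nontrivial W] {p : K → W} {m : K → K}
    (hm : Function.Involutive m) {d : ℕ} (hd : ∀ w, Nat.card {h // p h = w} ≤ d)
    (hcut : CutsAtLeast p m d) {a : K} (ha : m a = a) :
    ∃ b, m b = b ∧ b ≠ a ∧
      ∀ X : Set W, Xᶜ.Nonempty → p a ∈ X → p b ∈ X → legCut p m X ≠ d := by
  classical
  have hsingle : legCut p m {p a} ≤ d := by
    refine le_trans ?_ (hd (p a))
    rw [legCut, Nat.card_eq_fintype_card, Fintype.card_subtype, Finset.card_filter]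
    refine Finset.sum_le_sum fun h _ => ?_
    unfold cutIndicator
    by_cases h1 : p h = p a
    · simp only [h1, if_true]; split_ifs <;> simp
    · simp [h1]
  obtain ⟨y, hy⟩ := exists_ne (p a)
  let F : Set (Set W) := {X | Xᶜ.Nonempty ∧ p a ∈ X ∧ legCut p m X = d}
  -- By the degree bound the cut around `p a` alone is already minimum, so there is a maximal
  -- minimum cut `X` containing `p a`.
  have hF : {p a} ∈ F := ⟨⟨y, hy⟩, rfl, hsingle.antisymm (hcut _ ⟨_, rfl⟩ ⟨y, hy⟩)⟩
  obtain ⟨X, hX⟩ := F.toFinite.exists_maximal ⟨_, hF⟩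
  obtain ⟨⟨hXc, haX, hXd⟩, hmax⟩ := hX
  -- If `X` contained all ends of the half-edges joined to the further vertex, the cut of `Xᶜ` would
  -- be smaller than `d`.
  have hb : ∃ b, m b = b ∧ p b ∉ X := by
    by_contra hcon
    push Not at hcon
    have h1 := legCut_compl_add p hm X hcon
    have h2 := hcut Xᶜ hXc (by rw [compl_compl]; exact ⟨_, haX⟩)
    have h3 : 1 ≤ ∑ h, (if m h = h then 1 else 0) := by
      refine le_trans ?_ (Finset.single_le_sum (fun _ _ => Nat.zero_le _) (Finset.mem_univ a))
      simp [ha]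
    omega
  obtain ⟨b, hb, hbX⟩ := hb
  refine ⟨b, hb, fun e => hbX (e ▸ haX), fun Y hYc haY hbY hYd => ?_⟩
  -- If `X ∪ Y` is not everything, submodularity makes it a minimum cut, against maximality of `X`.
  -- Otherwise `X \ Y` and `Y \ X` are sides of cuts, and the surplus from `a` pushes one of them
  -- below `d`.
  by_cases hun : (X ∪ Y)ᶜ.Nonempty
  · have h1 := legCut_union_add_inter p m X Y
    have h2 := hcut (X ∩ Y) ⟨_, haX, haY⟩
      (hXc.mono (Set.compl_subset_compl.2 Set.inter_subset_left))
    have h3 := hcut (X ∪ Y) ⟨_, Or.inl haX⟩ hun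
    have h4 : X ∪ Y ∈ F := ⟨hun, Or.inl haX, by omega⟩
    exact hbX (hmax h4 Set.subset_union_left (Or.inr hbY))
  · have huniv : ∀ w, w ∈ X ∨ w ∈ Y := fun w => by
      by_contra h
      exact hun ⟨w, h⟩
    have h1 := legCut_sdiff_add_sdiff p hm X Y
    obtain ⟨x, hx⟩ := hXc
    obtain ⟨y, hy⟩ := hYc
    have h2 := hcut (X \ Y) ⟨y, (huniv y).resolve_right hy, hy⟩ ⟨p a, fun h => h.2 haY⟩
    have h3 := hcut (Y \ X) ⟨x, (huniv x).resolve_left hx, hx⟩ ⟨p a, fun h => h.2 haX⟩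
    have h4 : 2 ≤ ∑ h, (if m h = h ∧ p h ∈ X ∩ Y then 2 else 0) := by
      refine le_trans ?_ (Finset.single_le_sum (fun _ _ => Nat.zero_le _) (Finset.mem_univ a))
      simp [ha, haX, haY]
    omega

-- Composing `m` with the swap turns the fixed points `a` and `b` into a pair. Only these two
-- half-edges can leave the cut, and only if both lie at `X`.
open Classical in
theorem legCut_swap_add (p : K → W) {m : K → K} (hm : Function.Involutive m) {a b : K}
    (ha : m a = a) (hb : m b = b) (hab : b ≠ a) (X : Set W) :
    legCut p m X ≤ legCut p (fun h => Equiv.swap a b (m h)) X +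
      if p a ∈ X ∧ p b ∈ X then 2 else 0 := by
  have h2 : (if p a ∈ X ∧ p b ∈ X then 2 else 0) =
      ∑ h, ((if h = a ∧ p a ∈ X ∧ p b ∈ X then 1 else 0) +
        (if h = b ∧ p a ∈ X ∧ p b ∈ X then 1 else 0)) := by
    rw [Finset.sum_add_distrib]
    by_cases h : p a ∈ X ∧ p b ∈ X <;> simp [h]
  rw [h2, legCut, legCut, ← Finset.sum_add_distrib]
  refine Finset.sum_le_sum fun h _ => ?_
  unfold cutIndicator
  by_cases h3 : h = a
  · subst h3
    by_cases h4 : p h ∈ X <;> by_cases h5 : p b ∈ X <;> simp [ha, h4, h5]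
    omega
  by_cases h4 : h = b
  · subst h4
    by_cases h4 : p h ∈ X <;> by_cases h5 : p a ∈ X <;> simp [hb, h4, h5]
    omega
  · beta_reduce
    rw [Equiv.swap_apply_of_ne_of_ne (fun e => h3 (by rw [← hm h, e, ha]))
      (fun e => h4 (by rw [← hm h, e, hb]))]
    exact Nat.le_add_right _ _

/-- All half-edges joined to the further vertex can be paired off without creating cuts of size less
than `d`. -/
theorem exists_complete_splitting [Finite W] [Nontrivial W] {p : K → W} {d : ℕ} (hd2 : Even d)
    (hd : ∀ w, Nat.card {h // p h = w} = d) (n : ℕ) :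
    ∀ {m : K → K}, Function.Involutive m → CutsAtLeast p m d → Nat.card {h // m h = h} = n →
    ∃ m' : K → K, Function.Involutive m' ∧ (∀ h, m' h ≠ h) ∧ (∀ h, m h ≠ h → m' h = m h) ∧
      CutsAtLeast p m' d := by
  classical
  induction n using Nat.strong_induction_on with
  | _ n ih =>
    intro m hm hcut hn
    by_cases hfix : ∀ h, m h ≠ h
    · exact ⟨m, hm, hfix, fun _ _ => rfl, hcut⟩
    push Not at hfix
    obtain ⟨a, ha⟩ := hfix
    obtain ⟨b, hb, hba, hX⟩ := exists_partner hm (fun w => (hd w).le) hcut ha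
    have hmne : ∀ h, h ≠ a → h ≠ b → Equiv.swap a b (m h) = m h := fun h h1 h2 =>
      Equiv.swap_apply_of_ne_of_ne (fun e => h1 (by rw [← hm h, e, ha]))
        (fun e => h2 (by rw [← hm h, e, hb]))
    have hm' : Function.Involutive fun h => Equiv.swap a b (m h) := by
      intro h
      by_cases h1 : h = a
      · subst h1; simp [ha, hb]
      by_cases h2 : h = b
      · subst h2; simp [ha, hb]
      simp only [hmne h h1 h2, hm h]
      exact Equiv.swap_apply_of_ne_of_ne h1 h2
    have hcut' : CutsAtLeast p (fun h => Equiv.swap a b (m h)) d := by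
      intro X hXn hXc
      have h1 := legCut_swap_add p hm ha hb hba X
      have h2 := hcut X hXn hXc
      by_cases h3 : p a ∈ X ∧ p b ∈ X
      · rw [if_pos h3] at h1
        have h4 := hX X hXc h3.1 h3.2
        -- Cuts are even, so a cut that is not minimum has size at least `d + 2` and can afford the
        -- loss of two.
        obtain ⟨r, hr⟩ := even_legCut p hm X (by rw [card_fiber_mem hd]; exact hd2.mul_left _)
        obtain ⟨s, hs⟩ := hd2
        omega
      · rw [if_neg h3] at h1
        omega
    have hlt : Nat.card {h // Equiv.swap a b (m h) = h} < n := by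
      rw [← hn]
      refine Set.ncard_lt_ncard (s := {h | Equiv.swap a b (m h) = h}) (t := {h | m h = h}) ?_
        (Set.toFinite _)
      refine ⟨fun h hh => ?_, fun hs => ?_⟩
      · by_cases h1 : h = a
        · exact h1 ▸ ha
        by_cases h2 : h = b
        · exact h2 ▸ hb
        have hh' : Equiv.swap a b (m h) = h := hh
        rwa [hmne h h1 h2] at hh'
      · have : Equiv.swap a b (m a) = a := hs ha
        rw [ha, Equiv.swap_apply_left] at this
        exact hba this
    obtain ⟨m'', h1, h2, h3, h4⟩ := ih _ hlt hm' hcut' rfl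
    refine ⟨m'', h1, h2, fun h hh => ?_, h4⟩
    have ha' : h ≠ a := fun e => hh (by rw [e, ha])
    have hb' : h ≠ b := fun e => hh (by rw [e, hb])
    have h5 := hmne h ha' hb'
    rw [h3 h (by rwa [h5]), h5]

end Splitting

/-! ### Positivity for high edge connectivity. -/

namespace Multigraph

universe u v

variable {V V' : Type u} {H H' : Type v}

theorem cutSize_eq_legCut [Fintype H] (G : Multigraph V H) (X : Set V) :
    G.cutSize X = legCut G.vert G.opp X := by
  rw [legCut_eq_card]
  exact Nat.card_congr (Equiv.subtypeEquivRight fun h => by simp [G.opp_ne])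

/-- Every vertex without self-loops has a transition which preserves high edge connectivity. -/
theorem exists_transition_cutSize [Finite V] [Finite H] {G : Multigraph V H} {k : ℕ}
    (hG : G.IsRegular (2 * k)) (hV : 3 ≤ Nat.card V) {v : V} (hv : ¬ G.HasSelfLoopAt v)
    (hcut : ∀ X : Set V, X.Nonempty → Xᶜ.Nonempty → 2 * k ≤ G.cutSize X) :
    ∃ τ : G.Transition v, ∀ X, X.Nonempty → Xᶜ.Nonempty →
      2 * k ≤ (G.resolve v hv τ).cutSize X := by
  classical
  have := Fintype.ofFinite H
  have : Nontrivial {w // w ≠ v} := by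
    rw [← Finite.one_lt_card_iff_nontrivial, card_ne]
    omega
  let p : {h : H // G.vert h ≠ v} → {w // w ≠ v} := fun h => ⟨G.vert h.1, h.2⟩
  -- Half-edges joined to `v` are fixed by `m`: here `v` is the further vertex of the splitting.
  let m : {h : H // G.vert h ≠ v} → {h : H // G.vert h ≠ v} := fun h =>
    if hh : G.vert (G.opp h.1) = v then h else ⟨G.opp h.1, hh⟩
  have hm₁ : ∀ h, G.vert (G.opp h.1) = v → m h = h := fun h hh => by simp [m, hh]
  have hm₂ : ∀ h (hh : G.vert (G.opp h.1) ≠ v), m h = ⟨G.opp h.1, hh⟩ := fun h hh => by simp [m, hh]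
  have hfix : ∀ h, m h = h ↔ G.vert (G.opp h.1) = v := fun h => by
    refine ⟨fun e => ?_, hm₁ h⟩
    by_contra hh
    rw [hm₂ h hh] at e
    exact G.opp_ne h.1 (congrArg Subtype.val e)
  have hm : Function.Involutive m := by
    intro h
    by_cases hh : G.vert (G.opp h.1) = v
    · rw [hm₁ h hh, hm₁ h hh]
    · rw [hm₂ h hh, hm₂ _ (by rw [G.opp_opp]; exact h.2)]
      exact Subtype.ext (G.opp_opp _)
  have hd : ∀ w, Nat.card {h // p h = w} = 2 * k := by
    rintro ⟨w, hw⟩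
    rw [← hG w]
    exact Nat.card_congr
      { toFun := fun h => ⟨h.1.1, congrArg Subtype.val h.2⟩
        invFun := fun h => ⟨⟨h.1, fun e => hw (h.2.symm.trans e)⟩, Subtype.ext h.2⟩
        left_inv := fun h => rfl
        right_inv := fun h => rfl }
  have hcut₀ : CutsAtLeast p m (2 * k) := by
    intro X hX hXc
    -- A set of remaining vertices is a side of a cut of `G` whose other side contains `v`.
    have hv' : v ∉ Subtype.val '' X := by
      rintro ⟨w, -, hw⟩
      exact w.2 hw
    have hK : ∀ h, G.vert h ∈ Subtype.val '' X → G.vert h ≠ v := fun h h1 h2 =>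
      hv' (by rwa [h2] at h1)
    refine (hcut (Subtype.val '' X) (hX.image _) ⟨v, hv'⟩).trans ?_
    rw [legCut_eq_card]
    refine Nat.card_le_card_of_injective (fun h => ⟨⟨h.1, hK h.1 h.2.1⟩, ?_, ?_⟩) ?_
    · obtain ⟨w, hw, e⟩ := h.2.1
      have : p ⟨h.1, hK h.1 h.2.1⟩ = w := Subtype.ext e.symm
      exact this ▸ hw
    · by_cases hh : G.vert (G.opp h.1) = v
      · exact Or.inl (hm₁ _ hh)
      · refine Or.inr fun hmem => h.2.2 ⟨_, hmem, ?_⟩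
        rw [hm₂ _ hh]
    · intro a b hab
      have : a.1 = b.1 := congrArg (fun z => z.1.1) hab
      exact Subtype.ext this
  obtain ⟨m', hi, hne, hag, hc⟩ :=
    exists_complete_splitting (even_two_mul k) hd _ hm hcut₀ rfl
  let π : {π : PerfectMatching {h : H // G.vert h ≠ v} //
      ∀ h, G.vert (G.opp h.1) ≠ v → (π.mate h).1 = G.opp h.1} :=
    ⟨⟨m', hi, hne⟩, fun h hh => by
      have h1 := hag h (fun e => hh ((hfix h).1 e))
      rw [hm₂ h hh] at h1
      exact congrArg Subtype.val h1⟩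
  refine ⟨(G.transitionEquiv v hv).symm π, fun X hX hXc => ?_⟩
  have h1 : (G.resolve v hv ((G.transitionEquiv v hv).symm π)).edges = π.1 :=
    congrArg Subtype.val ((G.transitionEquiv v hv).apply_symm_apply π)
  have h2 : (G.resolve v hv ((G.transitionEquiv v hv).symm π)).opp = m' := by
    funext h
    rw [opp, h1]
    rfl
  rw [cutSize_eq_legCut, h2]
  exact hc X hX hXc

theorem martin_pos_of_le_cutSize (k n : ℕ) : ∀ {V : Type u} {H : Type v} [Finite V] [Finite H]
    (G : Multigraph V H), Nat.card V = n + 1 → G.IsRegular (2 * k) →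
    (∀ X : Set V, X.Nonempty → Xᶜ.Nonempty → 2 * k ≤ G.cutSize X) → 0 < G.martin k := by
  induction n with
  | zero =>
    intro V H _ _ G hV hG hcut
    rw [martin_of_card_one k G hV]
    positivity
  | succ n ih =>
    intro V H _ _ G hV hG hcut
    have hnt : Nontrivial V := by
      rw [← Finite.one_lt_card_iff_nontrivial]
      omega
    have hl : ¬ G.HasSelfLoop := by
      rintro ⟨v, hv⟩
      obtain ⟨w, hw⟩ := exists_ne v
      have h1 := cutSize_singleton_lt G hv
      have h2 := hcut {v} ⟨v, rfl⟩ ⟨w, hw⟩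
      rw [hG v] at h1
      omega
    match n with
    | 0 => rw [martin_of_card_two k hl hV]; positivity
    | 1 => rw [martin_of_card_three k hl hV]; norm_num
    | n + 2 =>
      obtain ⟨v, hv⟩ := exists_martin_eq_sum k hl (by omega)
      obtain ⟨τ, hτ⟩ := exists_transition_cutSize hG (by omega) (fun h => hl ⟨v, h⟩) hcut
      rw [hv]
      refine Finset.sum_pos' (fun τ _ => martin_nonneg k _) ⟨τ, Finset.mem_univ _, ?_⟩
      exact ih _ (by rw [card_ne]; omega) (resolve_isRegular hG _ _ _) hτ

/-! ### Replacing a side of a cut by a vertex -/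

section

variable (G : Multigraph V H) (X : Set V)

theorem replaceCompl_vert_of_mem {h : {h : H // G.vert h ∈ X ∨ G.vert (G.opp h) ∈ X}}
    (hh : G.vert h.1 ∈ X) : (G.replaceCompl X).vert h = some ⟨G.vert h.1, hh⟩ := by
  simp [replaceCompl, hh]

theorem replaceCompl_vert_eq_none_iff {h : {h : H // G.vert h ∈ X ∨ G.vert (G.opp h) ∈ X}} :
    (G.replaceCompl X).vert h = none ↔ G.vert h.1 ∉ X := by
  by_cases hh : G.vert h.1 ∈ X <;> simp [replaceCompl, hh]

theorem replaceCompl_vert_eq_some_iff {h : {h : H // G.vert h ∈ X ∨ G.vert (G.opp h) ∈ X}}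
    {x : X} : (G.replaceCompl X).vert h = some x ↔ G.vert h.1 = x.1 := by
  by_cases hh : G.vert h.1 ∈ X
  · simp [replaceCompl, hh, Subtype.ext_iff]
  · simp only [replaceCompl, hh, dite_false]
    exact ⟨fun e => (by cases e), fun e => absurd (e ▸ x.2) hh⟩

theorem not_hasSelfLoopAt_none : ¬ (G.replaceCompl X).HasSelfLoopAt none := by
  rintro ⟨h, h1, h2⟩
  rw [replaceCompl_vert_eq_none_iff] at h1 h2
  exact h.2.elim h1 h2

theorem hasSelfLoopAt_some_iff (x : X) :
    (G.replaceCompl X).HasSelfLoopAt (some x) ↔ G.HasSelfLoopAt x := by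
  constructor
  · rintro ⟨h, h1, h2⟩
    rw [replaceCompl_vert_eq_some_iff] at h1 h2
    exact ⟨h.1, h1, h2⟩
  · rintro ⟨h, h1, h2⟩
    refine ⟨⟨h, Or.inl (h1 ▸ x.2)⟩, ?_, ?_⟩
    · exact (replaceCompl_vert_eq_some_iff _ _).2 h1
    · exact (replaceCompl_vert_eq_some_iff _ _).2 h2

theorem not_hasSelfLoop_replaceCompl (hX : ∀ x ∈ X, ¬ G.HasSelfLoopAt x) :
    ¬ (G.replaceCompl X).HasSelfLoop := by
  rintro ⟨_ | x, hx⟩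
  · exact G.not_hasSelfLoopAt_none X hx
  · exact hX x x.2 ((G.hasSelfLoopAt_some_iff X x).1 hx)

theorem replaceCompl_isRegular {d : ℕ} (hG : G.IsRegular d) (hX : G.cutSize X = d) :
    (G.replaceCompl X).IsRegular d := by
  rintro (_ | x)
  · rw [← hX, ← cutSize_compl]
    exact Nat.card_congr
      { toFun := fun h => ⟨h.1.1, (replaceCompl_vert_eq_none_iff _ _).1 h.2, fun h' =>
          h' (h.1.2.resolve_left ((replaceCompl_vert_eq_none_iff _ _).1 h.2))⟩
        invFun := fun h => ⟨⟨h.1, Or.inr (not_not.1 h.2.2)⟩,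
          (replaceCompl_vert_eq_none_iff _ _).2 h.2.1⟩
        left_inv := fun h => rfl
        right_inv := fun h => rfl }
  · rw [← hG x]
    exact Nat.card_congr
      { toFun := fun h => ⟨h.1.1, (replaceCompl_vert_eq_some_iff _ _).1 h.2⟩
        invFun := fun h => ⟨⟨h.1, Or.inl (by rw [h.2]; exact x.2)⟩,
          (replaceCompl_vert_eq_some_iff _ _).2 h.2⟩
        left_inv := fun h => rfl
        right_inv := fun h => rfl }

theorem two_le_card_option [Finite V] (hX : X.Nonempty) : 2 ≤ Nat.card (Option X) := by
  have := hX.to_subtype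
  have := Nat.card_pos (α := X)
  rw [Finite.card_option]
  omega

/-- The half-edges of `G.replaceCompl X` away from the new vertex are those of `G` at `X`. -/
def replaceComplAway : {h // (G.replaceCompl X).vert h ≠ none} ≃ {h : H // G.vert h ∈ X} where
  toFun h := ⟨h.1.1, not_not.1 (mt (replaceCompl_vert_eq_none_iff G X).2 h.2)⟩
  invFun h := ⟨⟨h.1, Or.inl h.2⟩, fun e => (replaceCompl_vert_eq_none_iff G X).1 e h.2⟩
  left_inv _ := rfl
  right_inv _ := rfl

theorem replaceComplAway_symm_vert (h : {h : H // G.vert h ∈ X}) :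
    (G.replaceCompl X).vert ((G.replaceComplAway X).symm h).1 = some ⟨G.vert h.1, h.2⟩ :=
  replaceCompl_vert_of_mem G X h.2

end

open Classical in
/-- Replacing a single vertex without self-loops by a vertex. -/
noncomputable def singletonIso (G : Multigraph V H) {v : V} (hv : ¬ G.HasSelfLoopAt v) :
    Iso G (G.replaceCompl {v}ᶜ) :=
  Iso.ofAway hv (G.not_hasSelfLoopAt_none {v}ᶜ)
    { toFun := fun x => if h : x = v then none else some ⟨x, h⟩
      invFun := fun x => x.elim v fun x => x.1
      left_inv := fun x => by by_cases h : x = v <;> simp [h]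
      right_inv := by
        rintro (_ | ⟨x, hx⟩)
        · simp
        · have : ¬ x = v := hx
          simp [this] }
    (by simp)
    (G.replaceComplAway {v}ᶜ).symm
    (fun h => by
      have := h.2
      refine (replaceCompl_vert_of_mem G {v}ᶜ (h := ⟨h.1, Or.inl h.2⟩) h.2).trans ?_
      simp [this])
    (fun h hh => by
      rw [replaceCompl_vert_eq_none_iff]
      exact fun h' => h' hh)
    (fun h hh => rfl)

section

variable {G : Multigraph V H} {X : Set V} {v : V} {hv : ¬ G.HasSelfLoopAt v} {τ : G.Transition v}

/-- For a transition at `v ∈ X` without pairs on the other side of the cut, the cut edges stay. -/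
theorem resolve_opp_mem_iff (hvX : v ∈ X)
    (hτ : ∀ a, G.vert a.1 ∉ X → G.vert (τ.mate a).1 ∈ X) (h : {h : H // G.vert h ≠ v})
    (hh : G.vert h.1 ∉ X) :
    G.vert ((G.resolve v hv τ).opp h).1 ∈ X ↔ G.vert (G.opp h.1) ∈ X := by
  by_cases h1 : G.vert (G.opp h.1) = v
  · rw [resolve_opp_of_eq _ _ _ _ _ h1, h1]
    exact iff_of_true (hτ ⟨h.1, h1⟩ hh) hvX
  · rw [resolve_opp_of_ne _ _ _ _ _ h1]

theorem cutSize_resolve_eq (hvX : v ∈ X)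
    (hτ : ∀ a, G.vert a.1 ∉ X → G.vert (τ.mate a).1 ∈ X) :
    (G.resolve v hv τ).cutSize (restrict X v) = G.cutSize X := by
  rw [← cutSize_compl, ← cutSize_compl G]
  have hne : ∀ {h}, G.vert h ∉ X → G.vert h ≠ v := fun h1 h2 => h1 (by rwa [h2])
  exact Nat.card_congr
    { toFun := fun h => ⟨h.1.1, h.2.1, fun h' => h'
        ((resolve_opp_mem_iff hvX hτ h.1 h.2.1).1 (not_not.1 h.2.2))⟩
      invFun := fun h => ⟨⟨h.1, hne h.2.1⟩, h.2.1, fun h' => h'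
        ((resolve_opp_mem_iff (hv := hv) hvX hτ ⟨h.1, hne h.2.1⟩ h.2.1).2 (not_not.1 h.2.2))⟩
      left_inv := fun _ => rfl
      right_inv := fun _ => rfl }

/-- Counted on the side away from `v`, every cut half-edge of the resolution was one of `G`, and `a`
drops out because its new partner lies on its own side. -/
theorem cutSize_resolve_lt [Finite H] (hvX : v ∈ X)
    {a : {h : H // G.vert (G.opp h) = v}} (ha : G.vert a.1 ∉ X)
    (ha' : G.vert (τ.mate a).1 ∉ X) :
    (G.resolve v hv τ).cutSize (restrict X v) < G.cutSize X := by
  rw [← cutSize_compl, ← cutSize_compl G, ← restrict_compl]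
  have hav : G.vert a.1 ≠ v := fun e => ha (by rwa [e])
  have hlt : Nat.card {h : H // (G.vert h ∈ Xᶜ ∧ G.vert (G.opp h) ∉ Xᶜ) ∧ h ≠ a.1} <
      G.cutSize Xᶜ := by
    refine Set.ncard_lt_ncard (s := {h | (G.vert h ∈ Xᶜ ∧ G.vert (G.opp h) ∉ Xᶜ) ∧ h ≠ a.1})
      (t := {h | G.vert h ∈ Xᶜ ∧ G.vert (G.opp h) ∉ Xᶜ}) ⟨fun h hh => hh.1, fun hs => ?_⟩
      (Set.toFinite _)
    refine (hs ⟨ha, ?_⟩ : _ ∧ a.1 ≠ a.1).2 rfl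
    rw [a.2]
    exact fun h => h hvX
  refine lt_of_le_of_lt ?_ hlt
  refine Nat.card_le_card_of_injective (fun h => ⟨h.1.1, ⟨h.2.1,
    mem_of_resolve_cut (X := Xᶜ) (fun h' => h' hvX) h.2.2⟩, fun e => ?_⟩) ?_
  · have h1 := h.2.2
    obtain ⟨⟨x, hx⟩, h2⟩ := h
    obtain rfl : x = a.1 := e
    apply h1
    change G.vert ((G.resolve v hv τ).opp ⟨a.1, hx⟩).1 ∈ Xᶜ
    rw [resolve_opp_of_eq _ _ _ _ _ a.2]
    exact ha'
  · intro b c hbc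
    have : b.1.1 = c.1.1 := congrArg (fun z => z.1) hbc
    exact Subtype.ext (Subtype.ext this)

/-- Resolving a vertex on one side of a cut does not change the graph in which this side is
replaced by a vertex. -/
noncomputable def resolveComplIso (hvX : v ∈ X)
    (hτ : ∀ a, G.vert a.1 ∉ X → G.vert (τ.mate a).1 ∈ X) :
    Iso ((G.resolve v hv τ).replaceCompl (restrict X v)ᶜ) (G.replaceCompl Xᶜ) :=
  have hne : ∀ {h}, G.vert h ∉ X → G.vert h ≠ v := fun h1 h2 => h1 (by rwa [h2])
  -- The halves at the new vertex can differ: for a cut edge at `v`, the half at `v` is replaced by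
  -- the partner under `τ`. So only the half-edges away from the new vertex are compared.
  Iso.ofAway (not_hasSelfLoopAt_none _ _) (not_hasSelfLoopAt_none _ _)
    (Equiv.optionCongr
      { toFun := fun x => ⟨x.1.1, x.2⟩
        invFun := fun x => ⟨⟨x.1, fun e => x.2 (by rw [e]; exact hvX)⟩, x.2⟩
        left_inv := fun _ => rfl
        right_inv := fun _ => rfl }) rfl
    ((replaceComplAway _ _).trans (Equiv.trans
      { toFun := fun h => ⟨h.1.1, h.2⟩
        invFun := fun h => ⟨⟨h.1, hne h.2⟩, h.2⟩
        left_inv := fun _ => rfl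
        right_inv := fun _ => rfl } (replaceComplAway _ _).symm))
    (fun h => by
      obtain ⟨h, rfl⟩ := (replaceComplAway _ _).symm.surjective h
      rw [Equiv.trans_apply, Equiv.trans_apply, replaceComplAway_symm_vert,
        replaceComplAway_symm_vert]
      simp
      rfl)
    (fun h hh => by
      obtain ⟨h, rfl⟩ := (replaceComplAway _ _).symm.surjective h
      rw [replaceCompl_vert_eq_none_iff] at hh ⊢
      exact fun h' => h' ((resolve_opp_mem_iff (hv := hv) hvX hτ h.1 h.2).1 (not_not.1 hh)))
    (fun h hh => by
      obtain ⟨h, rfl⟩ := (replaceComplAway _ _).symm.surjective h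
      apply Subtype.ext
      have hh' := mt (replaceCompl_vert_eq_none_iff _ _).2 hh
      have h1 : G.vert ((G.resolve v hv τ).opp h.1).1 ∉ X := not_not.1 hh'
      rw [resolve_opp_mem_iff hvX hτ h.1 h.2] at h1
      exact (resolve_opp_of_ne G v hv τ h.1 (hne h1)).symm)

/-- The half-edges opposite to `v ∈ X` are not affected by replacing the complement of `X`. -/
def replaceComplOpp (G : Multigraph V H) (hvX : v ∈ X) : {h : H // G.vert (G.opp h) = v} ≃
    {h // (G.replaceCompl X).vert ((G.replaceCompl X).opp h) = some ⟨v, hvX⟩} where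
  toFun h := ⟨⟨h.1, Or.inr (by rw [h.2]; exact hvX)⟩, (replaceCompl_vert_eq_some_iff _ _).2 h.2⟩
  invFun h := ⟨h.1.1, (replaceCompl_vert_eq_some_iff _ _).1 h.2⟩
  left_inv _ := rfl
  right_inv _ := rfl

/-- In `G.replaceCompl X`, two cut edges paired at `v` become a self-loop at the new vertex. -/
theorem avoids_none_iff (hvX : v ∈ X) :
    (G.replaceCompl X).Avoids (PerfectMatching.congr (G.replaceComplOpp hvX) τ) none ↔
      ∀ a, G.vert a.1 ∉ X → G.vert (τ.mate a).1 ∈ X := by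
  unfold Avoids
  rw [← (G.replaceComplOpp hvX).forall_congr_right]
  refine forall_congr' fun a => ?_
  rw [PerfectMatching.congr_mate, ne_eq, replaceCompl_vert_eq_none_iff,
    replaceCompl_vert_eq_none_iff, not_not]
  rfl

theorem resolve_replaceCompl_opp (hvX : v ∈ X)
    (hv' : ¬ (G.replaceCompl X).HasSelfLoopAt (some ⟨v, hvX⟩))
    (h : {h // (G.replaceCompl X).vert h ≠ some ⟨v, hvX⟩}) :
    (((G.replaceCompl X).resolve (some ⟨v, hvX⟩) hv'
        (PerfectMatching.congr (G.replaceComplOpp hvX) τ)).opp h).1.1 =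
      ((G.resolve v hv τ).opp
        ⟨h.1.1, fun e => h.2 ((replaceCompl_vert_eq_some_iff _ _).2 e)⟩).1 := by
  by_cases hh : G.vert (G.opp h.1.1) = v
  · rw [resolve_opp_of_eq G _ _ _ _ hh,
      resolve_opp_of_eq _ _ _ _ _ ((replaceCompl_vert_eq_some_iff _ _).2 hh)]
    exact congrArg (fun z => z.1.1)
      (PerfectMatching.congr_mate (G.replaceComplOpp hvX) τ ⟨h.1.1, hh⟩)
  · rw [resolve_opp_of_ne G _ _ _ _ hh,
      resolve_opp_of_ne _ _ _ _ _ (mt (replaceCompl_vert_eq_some_iff _ _).1 hh)]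
    rfl

/-- Resolving a vertex of `X` commutes with replacing the complement of `X`. -/
noncomputable def resolveReplaceIso (hvX : v ∈ X)
    (hv' : ¬ (G.replaceCompl X).HasSelfLoopAt (some ⟨v, hvX⟩))
    (hτ : ∀ a, G.vert a.1 ∉ X → G.vert (τ.mate a).1 ∈ X) :
    Iso ((G.resolve v hv τ).replaceCompl (restrict X v))
      ((G.replaceCompl X).resolve (some ⟨v, hvX⟩) hv'
        (PerfectMatching.congr (G.replaceComplOpp hvX) τ)) :=
  Iso.ofAway (x := none) (x' := ⟨none, by simp⟩) (not_hasSelfLoopAt_none _ _)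
    (by
      rw [hasSelfLoopAt_resolve_iff hv' (not_hasSelfLoopAt_none _ _), not_not, avoids_none_iff]
      exact hτ)
    { toFun := fun x => match x with
        | none => ⟨none, by simp⟩
        | some x => ⟨some ⟨x.1.1, x.2⟩, fun e => x.1.2 (by simpa [Subtype.ext_iff] using e)⟩
      invFun := fun x => match x with
        | ⟨none, _⟩ => none
        | ⟨some x, hx⟩ => some ⟨⟨x.1, fun e => hx (by simp [← e])⟩, x.2⟩
      left_inv := by rintro (_ | x) <;> rfl
      right_inv := by rintro ⟨_ | x, hx⟩ <;> rfl }
    rfl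
    ((replaceComplAway _ _).trans
      { toFun := fun h => ⟨⟨⟨h.1.1, Or.inl h.2⟩, fun e => h.1.2
            ((replaceCompl_vert_eq_some_iff _ _).1 e)⟩, fun e =>
            (replaceCompl_vert_eq_none_iff _ _).1 (congrArg Subtype.val e) h.2⟩
        invFun := fun h => ⟨⟨h.1.1.1, fun e => h.1.2 ((replaceCompl_vert_eq_some_iff _ _).2 e)⟩,
          not_not.1 fun h' => h.2 (Subtype.ext ((replaceCompl_vert_eq_none_iff _ _).2 h'))⟩
        left_inv := fun _ => rfl
        right_inv := fun _ => rfl })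
    (fun h => by
      obtain ⟨h, rfl⟩ := (replaceComplAway _ _).symm.surjective h
      rw [replaceComplAway_symm_vert]
      exact Subtype.ext (replaceCompl_vert_of_mem G X (h := ⟨h.1.1, Or.inl h.2⟩) h.2))
    (fun h hh => by
      obtain ⟨h, rfl⟩ := (replaceComplAway _ _).symm.surjective h
      rw [replaceCompl_vert_eq_none_iff] at hh
      refine Subtype.ext ((replaceCompl_vert_eq_none_iff G X).2 ?_)
      rw [resolve_replaceCompl_opp (hv := hv)]
      exact hh)
    (fun h hh => by
      obtain ⟨h, rfl⟩ := (replaceComplAway _ _).symm.surjective h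
      refine Subtype.ext (Subtype.ext ?_)
      rw [resolve_replaceCompl_opp (hv := hv)]
      rfl)

end

theorem martin_eq_mul (k n : ℕ) : ∀ {V : Type u} {H : Type v} [Finite V] [Finite H]
    (G : Multigraph V H), Nat.card V = n → G.IsRegular (2 * k) → ∀ X : Set V, X.Nonempty →
    Xᶜ.Nonempty → G.cutSize X = 2 * k → G.martin k =
      k.factorial * (G.replaceCompl X).martin k * (G.replaceCompl Xᶜ).martin k := by
  induction n with
  | zero =>
    intro V H _ _ G hn hG X ⟨x, _⟩
    have := Nat.card_pos_iff.2 ⟨⟨x⟩, (inferInstance : Finite V)⟩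
    omega
  | succ n ih =>
    intro V H _ _ G hn hG X hX hXc hcut
    have hV : 2 ≤ Nat.card V := by
      obtain ⟨x, hx⟩ := hX
      obtain ⟨y, hy⟩ := hXc
      have : Nontrivial V := ⟨x, y, fun e => hy (e ▸ hx)⟩
      exact Finite.one_lt_card
    have hcut' : G.cutSize Xᶜ = 2 * k := by rw [cutSize_compl, hcut]
    obtain ⟨v, hvX⟩ := hX
    by_cases hXv : X = {v}
    · subst hXv
      have hv : ¬ G.HasSelfLoopAt v := fun h => by
        have := cutSize_singleton_lt G h
        rw [hcut, hG v] at this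
        exact lt_irrefl _ this
      -- The value `1 / k!` of the `2k`-fold edge cancels the factor `k!`; the other factor is `G`
      -- itself up to isomorphism.
      have h1 : (G.replaceCompl {v}).martin k = 1 / k.factorial := by
        refine martin_of_card_two k (G.not_hasSelfLoop_replaceCompl {v} ?_) ?_
        · rintro x rfl
          exact hv
        · rw [Finite.card_option]
          simp
      rw [h1, ← (G.singletonIso hv).martin_eq hG hV]
      have : (k.factorial : ℚ) ≠ 0 := by exact_mod_cast k.factorial_ne_zero
      field_simp
    by_cases hl : G.HasSelfLoop
    · rw [martin_eq_zero_of_hasSelfLoop k hl hV]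
      obtain ⟨x, hx⟩ := hl
      -- A self-loop of `G` survives in the graph that keeps its vertex, so both sides are zero.
      by_cases hxX : x ∈ X
      · rw [martin_eq_zero_of_hasSelfLoop k ⟨_, (G.hasSelfLoopAt_some_iff X ⟨x, hxX⟩).2 hx⟩
          (two_le_card_option X ⟨v, hvX⟩)]
        simp
      · rw [martin_eq_zero_of_hasSelfLoop k ⟨_, (G.hasSelfLoopAt_some_iff Xᶜ ⟨x, hxX⟩).2 hx⟩
          (two_le_card_option Xᶜ hXc)]
        simp
    have hl' : ∀ x, ¬ G.HasSelfLoopAt x := fun x h => hl ⟨x, h⟩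
    have hres : (restrict X v).Nonempty := by
      by_contra h
      apply hXv
      refine Set.eq_singleton_iff_unique_mem.2 ⟨hvX, fun y hy => ?_⟩
      by_contra hyv
      exact h ⟨⟨y, hyv⟩, hy⟩
    have hresc : (restrict X v)ᶜ.Nonempty := by
      obtain ⟨y, hy⟩ := hXc
      exact ⟨⟨y, fun e => hy (by rwa [e])⟩, hy⟩
    have hXcard : 2 ≤ Nat.card X := by
      obtain ⟨y, hy⟩ := hres
      have : Nontrivial X := ⟨⟨v, hvX⟩, ⟨y.1, hy⟩, fun e => y.2 (congrArg Subtype.val e).symm⟩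
      exact Finite.one_lt_card
    have hlR := G.not_hasSelfLoop_replaceCompl X fun x _ => hl' x
    have hRreg := G.replaceCompl_isRegular X hG hcut
    have hV3 : 3 ≤ Nat.card V := by
      have h1 : Nat.card X + Nat.card ↥Xᶜ = Nat.card V := Set.ncard_add_ncard_compl X
      have := hXc.to_subtype
      have h2 := Nat.card_pos (α := ↥Xᶜ)
      omega
    rw [martin_eq_sum hG hV3 hl v,
      martin_eq_sum hRreg (by rw [Finite.card_option]; omega) hlR (some ⟨v, hvX⟩),
      Finset.mul_sum, Finset.sum_mul]
    refine Fintype.sum_equiv (PerfectMatching.congr (G.replaceComplOpp hvX)) _ _ fun τ => ?_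
    have hreg := resolve_isRegular hG v (hl' v) τ
    -- Terms are compared one by one, according to whether `τ` pairs two edges of the cut.
    by_cases hτ : ∀ a, G.vert a.1 ∉ X → G.vert (τ.mate a).1 ∈ X
    · have hc : (G.resolve v (hl' v) τ).cutSize (restrict X v) = 2 * k := by
        rw [cutSize_resolve_eq hvX hτ, hcut]
      rw [ih (G.resolve v (hl' v) τ) (by rw [card_ne]; omega) hreg (restrict X v) hres hresc hc,
        (resolveReplaceIso hvX (fun h => hlR ⟨_, h⟩) hτ).martin_eq
          (replaceCompl_isRegular _ _ hreg hc) (two_le_card_option _ hres),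
        (resolveComplIso hvX hτ).martin_eq
          (replaceCompl_isRegular _ _ hreg (by rw [cutSize_compl, hc]))
          (two_le_card_option _ hresc)]
    · have hτ' := hτ
      push Not at hτ'
      obtain ⟨a, ha, ha'⟩ := hτ'
      rw [martin_eq_zero_of_cutSize_lt k _ _ rfl hreg _ hres hresc
        ((cutSize_resolve_lt hvX ha ha').trans_eq hcut)]
      have hloop := (hasSelfLoopAt_resolve_iff (fun h => hlR ⟨some ⟨v, hvX⟩, h⟩)
        (G.not_hasSelfLoopAt_none X) (by simp)
        (PerfectMatching.congr (G.replaceComplOpp hvX) τ)).2 (mt (avoids_none_iff hvX).1 hτ)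
      rw [martin_eq_zero_of_hasSelfLoop k ⟨_, hloop⟩
        (by rw [card_ne, Finite.card_option]; omega)]
      simp

end Multigraph

theorem mainTheorem4 {V H : Type*} [Finite V] [Finite H] [Nonempty V] (k : ℕ)
    (G : Multigraph V H) (hG : G.IsRegular (2 * k)) :
    -- the recursion for the Martin invariant holds at every vertex
    (4 ≤ Nat.card V → ∀ hloop : ¬ G.HasSelfLoop, ∀ v : V,
      G.martin k = ∑ τ : G.Transition v, (G.resolve v (fun h => hloop ⟨v, h⟩) τ).martin k) ∧
    ((∃ X : Set V, ∃ s < 2 * k, G.IsEdgeCut X s) → G.martin k = 0) ∧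
    ((¬ ∃ X : Set V, ∃ s < 2 * k, G.IsEdgeCut X s) → 0 < G.martin k) ∧
    (∀ X : Set V, G.IsEdgeCut X (2 * k) →
      G.martin k =
        k.factorial * (G.replaceCompl X).martin k * (G.replaceCompl Xᶜ).martin k) := by
  refine ⟨fun hV hl v => Multigraph.martin_eq_sum hG (by omega) hl v, ?_, ?_, ?_⟩
  · rintro ⟨X, s, hs, hX, hXc, rfl⟩
    exact Multigraph.martin_eq_zero_of_cutSize_lt k _ G rfl hG X hX hXc hs
  · intro h
    obtain ⟨n, hn⟩ := Nat.exists_eq_add_of_le' (Nat.card_pos (α := V))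
    refine Multigraph.martin_pos_of_le_cutSize k n G hn hG fun X hX hXc => ?_
    by_contra hlt
    exact h ⟨X, _, not_le.1 hlt, hX, hXc, rfl⟩
  · rintro X ⟨hX, hXc, hcut⟩
    exact Multigraph.martin_eq_mul k _ G rfl hG X hX hXc hcut
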